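/- Let $d,T\ge 1$ be integers and let $f(\mathbf x)=\mathbb E_{\boldsymbol\xi}[f(\mathbf x;\boldsymbol\xi)]$ for $\mathbf x\in\mathbb R^d$, where $f(\mathbf x;\boldsymbol\xi)$ is integrable in $\boldsymbol\xi$ for every $\mathbf x$ and differentiable in $\mathbf x$. Let $\|\cdot\|$ be the Euclidean norm and assume that for every value of $\boldsymbol\xi$: (A1) $\nabla f(\cdot;\boldsymbol\xi)$ is $L_g$-Lipschitz continuous with respect to $\|\cdot\|$, where $L_g>0$; (A2) $\|\nabla f(\mathbf x;\boldsymbol\xi)\|_\infty\le\eta$ for all $\mathbf x\in\mathbb R^d$. Set $\mu=\alpha=1/\sqrt{Td}$ and $f_\mu(\mathbf x)=\mathbb E[f(\mathbf x+\mu\mathbf u)]$ with $\mathbf u$ uniform on the closed unit Euclidean ball. Let $0\le\beta_1$, $0<\beta_2<1$, $\gamma:=\beta_1/\beta_2<1$ and $c>0$. Fix $\mathbf x_1\in\mathbb R^d$, put $\mathbf m_0=\mathbf v_0=\mathbf 0$, and let $\hat{\mathbf v}_0\in\mathbb R^d$ satisfy $\sqrt{\hat{v}_{0,i}}\ge c$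 for every $i$. Unconstrained ZO-AdaMM computes, for $t=1,\dots,T$ (with the square, maximum, square root and division taken elementwise), $$\hat{\mathbf g}_t=\frac d\mu\big[f(\mathbf x_t+\mu\mathbf u_t;\boldsymbol\xi_t)-f(\mathbf x_t;\boldsymbol\xi_t)\big]\mathbf u_t,\qquad \mathbf m_t=\beta_1\mathbf m_{t-1}+(1-\beta_1)\hat{\mathbf g}_t,\qquad \mathbf v_t=\beta_2\mathbf v_{t-1}+(1-\beta_2)\hat{\mathbf g}_t^2,$$ $$\hat{\mathbf v}_t=\max(\hat{\mathbf v}_{t-1},\mathbf v_t),\qquad \hat{\mathbf V}_t=\mathrm{diag}(\hat{\mathbf v}_t),\qquad \mathbf x_{t+1}=\mathbf x_t-\alpha\,\hat{\mathbf V}_t^{-1/2}\mathbf m_t,$$ where $\boldsymbol\xi_1,\dots,\boldsymbol\xi_T$ are copies of $\boldsymbol\xi$, $\mathbf u_1,\dots,\mathbf u_T$ are uniform on the unit sphere of $\mathbb R^d$, $R$ is uniform on $\{1,\dots,T\}$, and all of these are mutually independent. Suppose that $f_\mu(\mathbf x_1)-f_\mu(\mathbf x)\le D_f$ for all $\mathbf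 x\in\mathbb R^d$. Then the random variables $\|\hat{\mathbf V}_R^{-1/4}\nabla f(\mathbf x_R)\|^2$ and $\max_{1\le t\le T}\|\hat{\mathbf g}_t\|_\infty$ are integrable, and $$\mathbb E\Big[\big\|\hat{\mathbf V}_R^{-1/4}\nabla f(\mathbf x_R)\big\|^2\Big]\le\frac{L_g^2}{2c}\frac dT+2D_f\frac{\sqrt d}{\sqrt T}+\frac{L_g(4+5\beta_1^2)(1-\beta_1)}{2(1-\beta_1)^2(1-\beta_2)(1-\gamma)}\frac{\sqrt d}{\sqrt T}+\frac2c\,\mathbb E\Big[2\eta^2+\frac{\eta\max_{1\le t\le T}\|\hat{\mathbf g}_t\|_\infty}{1-\beta_1}\Big]\frac dT.$$ -/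

import Mathlib

open MeasureTheory ProbabilityTheory

namespace ZOAdaMM

noncomputable section

/-- The space `ℝ^d` with the Euclidean norm. -/
abbrev Vec (d : ℕ) : Type := EuclideanSpace ℝ (Fin d)

/-- The `ℓ_∞` norm of a vector (the norm of the underlying function is the maximum norm). -/
def linfNorm {d : ℕ} (x : Vec d) : ℝ := ‖(WithLp.ofLp x : Fin d → ℝ)‖

/-- The objective `f(x) = 𝔼_ξ [f(x; ξ)]`, where `ξ` has law `ν` and `F s x` stands for `f(x; s)`. -/
def objective {d : ℕ} {Ξ : Type*} [MeasurableSpace Ξ] (ν : Measure Ξ)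
    (F : Ξ → Vec d → ℝ) (x : Vec d) : ℝ :=
  ∫ s, F s x ∂ν

/-- The smoothing function `f_μ(x) = 𝔼[f(x + μ u)]`, `u` uniform on the unit Euclidean ball. -/
def smoothing {d : ℕ} (μ : ℝ) (f : Vec d → ℝ) (x : Vec d) : ℝ :=
  ⨍ u in Metric.closedBall (0 : Vec d) 1, f (x + μ • u)

/-- The uniform probability distribution on the Euclidean unit sphere of `ℝ^d` (for `d ≥ 1`):
the normalized surface measure. -/
def sphereUniform (d : ℕ) : Measure (Metric.sphere (0 : Vec d) 1) :=
  ((volume : Measure (Vec d)).toSphere Set.univ)⁻¹ • (volume : Measure (Vec d)).toSphere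

/-- The zeroth-order gradient estimate `(d/μ) [g(x + μ u) - g(x)] u`. -/
def zoGrad {d : ℕ} (μ : ℝ) (g : Vec d → ℝ) (u : Vec d) (x : Vec d) : Vec d :=
  ((d : ℝ) / μ * (g (x + μ • u) - g x)) • u

/-- The variables kept by the algorithm: after `t` iterations these are
`x_{t+1}`, `m_t`, `v_t` and `v̂_t`. -/
structure State (d : ℕ) where
  x : Vec d
  m : Vec d
  v : Vec d
  vhat : Vec d

/-- One unconstrained iteration with gradient estimate `g`:
`m ← β₁ m + (1 - β₁) g`, `v ← β₂ v + (1 - β₂) g²`, `v̂ ← max(v̂, v)`, `x ← x - α V̂^{-1/2} m`,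
where `V̂ = diag(v̂)` and all operations are elementwise. -/
def step {d : ℕ} (α β₁ β₂ : ℝ) (g : Vec d) (S : State d) : State d :=
  let m : Vec d := β₁ • S.m + (1 - β₁) • g
  let v : Vec d := WithLp.toLp 2 fun i => β₂ * S.v i + (1 - β₂) * (g i) ^ 2
  let vhat : Vec d := WithLp.toLp 2 fun i => max (S.vhat i) (v i)
  { x := WithLp.toLp 2 fun i => S.x i - α * (m i / √(vhat i))
    m := m
    v := v
    vhat := vhat }

section Algorithm

variable {d : ℕ} {Ξ : Type*}

/-- The unconstrained algorithm (`𝒳 = ℝ^d`) started at `x₁` with `m₀ = 0`, `v₀ = 0` and `v̂₀`,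
step sizes `α t`, momentum parameters `β₁ t` and `β₂`, smoothing parameter `μ`,
run on the samples `ξ t` and the directions `u t`, `t = 1, 2, …`. -/
def run (F : Ξ → Vec d → ℝ) (μ : ℝ) (α β₁ : ℕ → ℝ) (β₂ : ℝ) (x₁ vhat₀ : Vec d)
    (ξ : ℕ → Ξ) (u : ℕ → Metric.sphere (0 : Vec d) 1) : ℕ → State d
  | 0 => { x := x₁, m := 0, v := 0, vhat := vhat₀ }
  | t + 1 =>
    let S := run F μ α β₁ β₂ x₁ vhat₀ ξ u t
    step (α (t + 1)) (β₁ (t + 1)) β₂ (zoGrad μ (F (ξ (t + 1))) (u (t + 1)) S.x) S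

/-- The iterate `x_t`, for `t ≥ 1`. -/
def iterate (F : Ξ → Vec d → ℝ) (μ : ℝ) (α β₁ : ℕ → ℝ) (β₂ : ℝ) (x₁ vhat₀ : Vec d)
    (ξ : ℕ → Ξ) (u : ℕ → Metric.sphere (0 : Vec d) 1) (t : ℕ) : Vec d :=
  (run F μ α β₁ β₂ x₁ vhat₀ ξ u (t - 1)).x

/-- The vector `v̂_t`, the diagonal of `V̂_t`. -/
def vhat (F : Ξ → Vec d → ℝ) (μ : ℝ) (α β₁ : ℕ → ℝ) (β₂ : ℝ) (x₁ vhat₀ : Vec d)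
    (ξ : ℕ → Ξ) (u : ℕ → Metric.sphere (0 : Vec d) 1) (t : ℕ) : Vec d :=
  (run F μ α β₁ β₂ x₁ vhat₀ ξ u t).vhat

/-- The gradient estimate `ĝ_t` of `f_t = f(·; ξ_t)` at `x_t` in the direction `u_t`,
for `t ≥ 1`. -/
def gradEst (F : Ξ → Vec d → ℝ) (μ : ℝ) (α β₁ : ℕ → ℝ) (β₂ : ℝ) (x₁ vhat₀ : Vec d)
    (ξ : ℕ → Ξ) (u : ℕ → Metric.sphere (0 : Vec d) 1) (t : ℕ) : Vec d :=
  zoGrad μ (F (ξ t)) (u t) (iterate F μ α β₁ β₂ x₁ vhat₀ ξ u t)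

/-- The convergence measure `‖V̂^{-1/4} g‖²` with `V̂ = diag(v)`. -/
def mahalanobisSq (v g : Vec d) : ℝ :=
  ‖(WithLp.toLp 2 fun i => (v i) ^ (-(1 / 4) : ℝ) * g i : Vec d)‖ ^ 2

/-- The randomness of `T` iterations: samples `ξ_1, …, ξ_T` with law `ν`, directions
`u_1, …, u_T` uniform on the unit sphere, and an index `R` uniform on `{1, …, T}`,
all of them mutually independent. -/
structure IsSampling {Ω : Type*} [MeasurableSpace Ω] [MeasurableSpace Ξ] (P : Measure Ω)
    (ν : Measure Ξ) (T : ℕ) (ξ : ℕ → Ω → Ξ) (u : ℕ → Ω → Metric.sphere (0 : Vec d) 1)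
    (R : Ω → ℕ) : Prop where
  measurable_sample : ∀ t ∈ Finset.Icc 1 T, Measurable (ξ t)
  measurable_dir : ∀ t ∈ Finset.Icc 1 T, Measurable (u t)
  measurable_index : Measurable R
  law_sample : ∀ t ∈ Finset.Icc 1 T, P.map (ξ t) = ν
  law_dir : ∀ t ∈ Finset.Icc 1 T, P.map (u t) = sphereUniform d
  law_index : ∀ t ∈ Finset.Icc 1 T, P {ω | R ω = t} = (T : ENNReal)⁻¹
  indep_sample_dir : ∀ t ∈ Finset.Icc 1 T, IndepFun (ξ t) (u t) P
  indep_time : iIndepFun (fun (t : Finset.Icc 1 T) (ω : Ω) => (ξ t ω, u t ω)) P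
  indep_index : IndepFun (fun (ω : Ω) (t : Finset.Icc 1 T) => (ξ t ω, u t ω)) R P

end Algorithm

end

end ZOAdaMM

/-! The argument is a descent argument for the smoothed objective `f_μ` along an auxiliary sequence
that removes the momentum. Write `D_t` for the diagonal matrix with entries `1/√v̂_{t,i}` and set
`z_t = x_t + β₁/(1-β₁) (x_t - x_{t-1})`, with `z_1 = x_1`. Then `z_{t+1} - z_t = -α D_t ĝ_t - α
β₁/(1-β₁) (D_t - D_{t-1}) m_{t-1}`, so the fresh estimate enters with full weight and the old
momentum only through the change of the preconditioner.

In the descent inequality for `f_μ` at `z_t`, the gradient is moved from `z_t` to `x_t` and `D_t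
ĝ_t` is replaced by `D_{t-1} ĝ_t`. Since `v̂` is coordinatewise nondecreasing, the changes `D_{t-1}
- D_t` are nonnegative and telescope, costing at most `d/c` in total. The other errors are quadratic
in `α`, because `v_t` controls both `ĝ_t²` and `m_t²` (`IsAdmissible.apply_extrapolate_step_le`,
`sum_inner_precond_le`).

The lagged preconditioner `D_{t-1}` depends only on the past, hence is independent of `(ξ_t, u_t)`.
So `ĝ_t` may be replaced in expectation by its conditional mean, the ball average `smoothGrad` of
the gradient (`IsSampling.integral_precond_gradEst`). This unbiasedness is the divergence theorem on
the unit ball, `setIntegral_ball_lineDeriv_eq_integral_toSphere`.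

Finally `D_t ≤ D_{t-1}` and `(a + b)² ≤ 2a² + 2b²` pass from the smoothed to the true gradient
(`mahalanobisSq_le`), with smoothing error at most `L μ d / 2`. Averaging over `R` and inserting `α
= μ = 1/√(Td)` gives the rate. -/

section SphereIntegration

/-! ### Polar coordinates and the divergence theorem on the unit ball. -/

open Metric Set Filter Topology

/-- The cone `x ↦ max (R - ‖x‖) 0` over a ball. -/
theorem lipschitzWith_max_sub_norm {E : Type*} [SeminormedAddCommGroup E] (R : ℝ) :
    LipschitzWith 1 (fun x : E => max (R - ‖x‖) 0) := by
  refine LipschitzWith.max_const ?_ 0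
  refine LipschitzWith.of_dist_le_mul fun x y => ?_
  rw [Real.dist_eq, dist_eq_norm, NNReal.coe_one, one_mul, sub_sub_sub_cancel_left,
    abs_sub_comm]
  exact abs_norm_sub_norm_le x y

theorem hasCompactSupport_max_sub_norm {E : Type*} [SeminormedAddCommGroup E] [ProperSpace E]
    (R : ℝ) :
    HasCompactSupport (fun x : E => max (R - ‖x‖) 0) := by
  refine HasCompactSupport.intro (isCompact_closedBall (0 : E) R) fun x hx => ?_
  simp only [mem_closedBall, dist_zero_right, not_le] at hx
  exact max_eq_right (by linarith)

/-- The direction is `-v` because that is what integration by parts produces. The excluded points,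
the origin and the sphere of radius `R`, form a null set. -/
theorem lineDeriv_max_sub_norm {E : Type*} [NormedAddCommGroup E] [InnerProductSpace ℝ E] {R : ℝ}
    {x : E} (hx : x ≠ 0) (hR : ‖x‖ ≠ R) (v : E) :
    lineDeriv ℝ (fun x : E => max (R - ‖x‖) 0) x (-v)
      = if ‖x‖ < R then inner ℝ x v / ‖x‖ else 0 := by
  split_ifs with h
  · have he : (fun x : E => max (R - ‖x‖) 0) =ᶠ[𝓝 x] fun x => R - ‖x‖ := by
      filter_upwards [(isOpen_lt continuous_norm continuous_const).mem_nhds h] with y hy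
      exact max_eq_left (sub_nonneg.2 (le_of_lt hy))
    rw [he.lineDeriv_eq]
    have h1 : HasDerivAt (fun t : ℝ => ‖x + t • (-v)‖ ^ 2) (2 * inner ℝ x (-v)) 0 := by
      have h0 : HasDerivAt (fun t : ℝ => x + t • (-v)) (-v) 0 := by
        simpa using ((hasDerivAt_id (0 : ℝ)).smul_const (-v)).const_add x
      simpa using h0.norm_sq
    have h2 := (h1.sqrt (by simpa using hx)).const_sub R
    have h3 : HasLineDerivAt ℝ (fun x : E => R - ‖x‖) (inner ℝ x v / ‖x‖) x (-v) := by
      unfold HasLineDerivAt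
      convert h2 using 1
      · ext t; simp
      · have : ‖x‖ ≠ 0 := by simpa using hx
        simp [inner_neg_right]
        field_simp
    exact h3.lineDeriv
  · have h' : R < ‖x‖ := lt_of_le_of_ne (not_lt.1 h) (Ne.symm hR)
    have he : (fun x : E => max (R - ‖x‖) 0) =ᶠ[𝓝 x] fun x => 0 := by
      filter_upwards [(isOpen_lt continuous_const continuous_norm).mem_nhds h'] with y hy
      exact max_eq_right (sub_nonpos.2 (le_of_lt hy))
    rw [he.lineDeriv_eq]
    simp [lineDeriv]

variable {E : Type*} [NormedAddCommGroup E] [InnerProductSpace ℝ E] [FiniteDimensional ℝ E]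
  [MeasurableSpace E] [BorelSpace E] [Nontrivial E]

/-- Integration in polar coordinates. -/
theorem integral_eq_integral_Ioi_toSphere (μ : Measure E) [μ.IsAddHaarMeasure] {h : E → ℝ}
    (hh : Integrable h μ) :
    ∫ x, h x ∂μ = ∫ r in Ioi (0 : ℝ), r ^ (Module.finrank ℝ E - 1) *
      ∫ w, h (r • (w : E)) ∂μ.toSphere := by
  have hmp := μ.measurePreserving_homeomorphUnitSphereProd
  have hint : Integrable (fun p : sphere (0 : E) 1 × Ioi (0 : ℝ) => h ((p.2 : ℝ) • (p.1 : E)))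
      (μ.toSphere.prod (.volumeIoiPow (Module.finrank ℝ E - 1))) := by
    rw [← hmp.integrable_comp_emb (Homeomorph.measurableEmbedding _)]
    have : Integrable (fun x : ({(0)}ᶜ : Set E) => h x) (μ.comap (↑)) := by
      have h2 : IntegrableOn h ({(0)}ᶜ : Set E) μ := hh.integrableOn
      rwa [integrableOn_iff_comap_subtypeVal (measurableSet_singleton _).compl] at h2
    refine this.congr (.of_forall fun x => ?_)
    have hx : ‖(x : E)‖ ≠ 0 := norm_ne_zero_iff.2 x.2
    simp [smul_smul, hx]
  calc
    ∫ x, h x ∂μ = ∫ x : ({(0)}ᶜ : Set E), h x ∂(μ.comap (↑)) := by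
      rw [integral_subtype_comap (measurableSet_singleton _).compl h, restrict_compl_singleton]
    _ = ∫ p : sphere (0 : E) 1 × Ioi (0 : ℝ), h ((p.2 : ℝ) • (p.1 : E))
        ∂μ.toSphere.prod (.volumeIoiPow (Module.finrank ℝ E - 1)) := by
      rw [← hmp.integral_comp (Homeomorph.measurableEmbedding _)]
      refine integral_congr_ae (.of_forall fun x => ?_)
      have hx : ‖(x : E)‖ ≠ 0 := norm_ne_zero_iff.2 x.2
      simp [smul_smul, hx]
    _ = ∫ r : Ioi (0 : ℝ), ∫ w, h ((r : ℝ) • (w : E)) ∂μ.toSphere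
          ∂(.volumeIoiPow (Module.finrank ℝ E - 1)) := integral_prod_symm _ hint
    _ = _ := by
      simp only [Measure.volumeIoiPow, ENNReal.ofReal]
      rw [integral_withDensity_eq_integral_smul,
        integral_subtype_comap measurableSet_Ioi fun a ↦
          Real.toNNReal (a ^ (Module.finrank ℝ E - 1)) • ∫ w, h (a • (w : E)) ∂μ.toSphere,
        setIntegral_congr_fun measurableSet_Ioi fun x hx ↦ ?_]
      · rw [NNReal.smul_def, Real.coe_toNNReal _ (pow_nonneg hx.out.le _), smul_eq_mul]
      · exact (measurable_subtype_coe.pow_const _).real_toNNReal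

/-- The divergence theorem on the unit ball for Lipschitz functions with a continuous
directional derivative. -/
theorem setIntegral_ball_lineDeriv_eq_integral_toSphere (μ : Measure E) [μ.IsAddHaarMeasure]
    {g p : E → ℝ} {K : NNReal} (hg : LipschitzWith K g) (hp : Continuous p) (v : E)
    (hgp : ∀ x, lineDeriv ℝ g x v = p x) :
    ∫ x in ball (0 : E) 1, p x ∂μ = ∫ w, g (w : E) * inner ℝ (w : E) v ∂μ.toSphere := by
  set n := Module.finrank ℝ E - 1 with hn
  set N : ℝ → ℝ := fun r => ∫ w, p (r • (w : E)) ∂μ.toSphere with hN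
  set M : ℝ → ℝ := fun r => ∫ w, g (r • (w : E)) * inner ℝ (w : E) v ∂μ.toSphere with hM
  have hgc := hg.continuous
  have hNc : Continuous N := by
    have := continuous_parametric_integral_of_continuous (μ := μ.toSphere)
      (f := fun (r : ℝ) (w : sphere (0 : E) 1) => p (r • (w : E))) (by fun_prop) isCompact_univ
    simpa using this
  have hMc : Continuous M := by
    have := continuous_parametric_integral_of_continuous (μ := μ.toSphere)
      (f := fun (r : ℝ) (w : sphere (0 : E) 1) => g (r • (w : E)) * inner ℝ (w : E) v)
      (by fun_prop) isCompact_univ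
    simpa using this
  have hIoi : ∀ (R : ℝ), 0 < R → ∀ f : ℝ → ℝ,
      ∫ r in Ioi (0 : ℝ), (if r < R then f r else 0) = ∫ r in (0 : ℝ)..R, f r := by
    intro R hR f
    rw [intervalIntegral.integral_of_le hR.le, ← integral_Ioc_eq_integral_Ioo.symm,
      ← Ioi_inter_Iio, ← setIntegral_indicator measurableSet_Iio]
    rfl
  -- Integration by parts against the compactly supported cone `(R - ‖x‖)₊`, whose gradient is the
  -- inward unit radial field inside the ball. Polar coordinates turn both sides into
  -- one-dimensional integrals.
  have key : ∀ R : ℝ, 0 < R →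
      ∫ r in (0 : ℝ)..R, (R - r) * (r ^ n * N r) = ∫ r in (0 : ℝ)..R, r ^ n * M r := by
    intro R hR
    have h1 := hg.integral_lineDeriv_mul_eq (μ := μ) (lipschitzWith_max_sub_norm (E := E) R)
      (hasCompactSupport_max_sub_norm R) v
    have h2 : ∀ᵐ x ∂μ, lineDeriv ℝ (fun x : E => max (R - ‖x‖) 0) x (-v) * g x
        = (if ‖x‖ < R then inner ℝ x v / ‖x‖ else 0) * g x := by
      have e1 : ∀ᵐ x ∂μ, x ≠ 0 := by simp [ae_iff]
      have e2 : ∀ᵐ x ∂μ, ‖x‖ ≠ R := by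
        have := Measure.addHaar_sphere μ (0 : E) R
        rw [ae_iff]
        convert this using 2
        ext; simp
      filter_upwards [e1, e2] with x hx1 hx2
      rw [lineDeriv_max_sub_norm hx1 hx2]
    simp_rw [hgp] at h1
    rw [integral_congr_ae h2, integral_eq_integral_Ioi_toSphere μ,
      integral_eq_integral_Ioi_toSphere μ]
      at h1
    · rw [← hIoi R hR, ← hIoi R hR]
      convert h1 using 1
      · refine setIntegral_congr_fun measurableSet_Ioi fun r (hr : 0 < r) => ?_
        simp only [hN]
        simp only [norm_smul, norm_eq_of_mem_sphere, mul_one, Real.norm_eq_abs, abs_of_pos hr]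
        rw [integral_mul_const]
        split_ifs with h
        · rw [max_eq_left (by linarith)]; ring
        · rw [max_eq_right (by linarith)]; ring
      · refine setIntegral_congr_fun measurableSet_Ioi fun r (hr : 0 < r) => ?_
        simp only [hM]
        simp only [norm_smul, norm_eq_of_mem_sphere, mul_one, Real.norm_eq_abs, abs_of_pos hr]
        split_ifs with h
        · congr 1
          refine integral_congr_ae (.of_forall fun w => ?_)
          simp only [inner_smul_left, RCLike.conj_to_real]
          field_simp
        · simp
    · have hl := lipschitzWith_max_sub_norm (E := E) R
      have hgi : Integrable ((closedBall (0 : E) R).indicator g) μ :=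
        (hgc.continuousOn.integrableOn_compact (isCompact_closedBall _ _)).integrable_indicator
          measurableSet_closedBall
      refine (hgi.bdd_mul (aestronglyMeasurable_lineDeriv hl.continuous μ)
        (.of_forall fun x => norm_lineDeriv_le_of_lipschitz ℝ hl (v := -v))).congr ?_
      filter_upwards [h2] with x hx
      by_cases hxR : x ∈ closedBall (0 : E) R
      · rw [indicator_of_mem hxR, hx]
      · have : ¬ ‖x‖ < R := fun h => hxR (by simpa using h.le)
        simp [indicator_of_notMem hxR, this]
    · exact (hp.mul (lipschitzWith_max_sub_norm (E := E) R).continuous).integrable_of_hasCompactSupport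
        (hasCompactSupport_max_sub_norm R).mul_left
  have hac : Continuous fun r => r ^ n * N r := by fun_prop
  have hbc : Continuous fun r => r ^ n * M r := by fun_prop
  have hrac : Continuous fun r => r * (r ^ n * N r) := by fun_prop
  have hA := intervalIntegral.integral_hasDerivAt_right (hac.intervalIntegrable 0 1)
    (hac.stronglyMeasurableAtFilter _ _) hac.continuousAt
  have hrA := intervalIntegral.integral_hasDerivAt_right (hrac.intervalIntegrable 0 1)
    (hrac.stronglyMeasurableAtFilter _ _) hrac.continuousAt
  have hB := intervalIntegral.integral_hasDerivAt_right (hbc.intervalIntegrable 0 1)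
    (hbc.stronglyMeasurableAtFilter _ _) hbc.continuousAt
  -- Differentiating `key` in `R` at `1` recovers the sphere integral. Writing the left side as `R ∫
  -- a - ∫ r a` with `a r = r ^ n * N r`, the two boundary terms cancel and only `∫₀¹ a`, the
  -- integral over the ball, survives.
  have hL := ((hasDerivAt_id (1 : ℝ)).mul hA).sub hrA
  have heq : (fun R : ℝ => ∫ r in (0 : ℝ)..R, r ^ n * M r) =ᶠ[𝓝 1]
      (id * fun R : ℝ => ∫ r in (0 : ℝ)..R, r ^ n * N r)
        - fun R : ℝ => ∫ r in (0 : ℝ)..R, r * (r ^ n * N r) := by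
    filter_upwards [lt_mem_nhds (zero_lt_one' ℝ)] with R hR
    rw [← key R hR]
    simp only [sub_mul, Pi.sub_apply, Pi.mul_apply, id]
    rw [intervalIntegral.integral_sub ((hac.const_mul R).intervalIntegrable _ _)
      (hrac.intervalIntegrable _ _), intervalIntegral.integral_const_mul]
  have hfin := (hL.congr_of_eventuallyEq heq).unique hB
  simp only [one_pow, one_mul, id, add_sub_cancel_right] at hfin
  have hM1 : M 1 = ∫ w, g (w : E) * inner ℝ (w : E) v ∂μ.toSphere := by simp [hM]
  rw [← hM1, ← hfin, ← integral_indicator measurableSet_ball,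
    integral_eq_integral_Ioi_toSphere μ, ← hIoi 1 one_pos]
  · refine setIntegral_congr_fun measurableSet_Ioi fun r (hr : 0 < r) => ?_
    simp only [hN, indicator, mem_ball, dist_zero_right, norm_smul, norm_eq_of_mem_sphere, mul_one,
      Real.norm_eq_abs, abs_of_pos hr]
    split_ifs with h <;> simp [hn]
  · exact ((hp.continuousOn.integrableOn_compact (isCompact_closedBall 0 1)).mono_set
      ball_subset_closedBall).integrable_indicator measurableSet_ball

/-- The mean distance from the origin in the unit ball of an `n`-dimensional space is
`n / (n + 1)`. -/
theorem setAverage_closedBall_norm (μ : Measure E) [μ.IsAddHaarMeasure] :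
    ⨍ x in closedBall (0 : E) 1, ‖x‖ ∂μ
      = Module.finrank ℝ E / (Module.finrank ℝ E + 1 : ℝ) := by
  have h := integral_fun_norm_addHaar μ (fun y : ℝ => (Iic (1 : ℝ)).indicator id y)
  have h1 : ∫ x, (Iic (1 : ℝ)).indicator id ‖x‖ ∂μ = ∫ x in closedBall (0 : E) 1, ‖x‖ ∂μ := by
    rw [← integral_indicator measurableSet_closedBall]
    refine integral_congr_ae (.of_forall fun x => ?_)
    simp [indicator]
  have h2 : ∫ y in Ioi (0 : ℝ), y ^ (Module.finrank ℝ E - 1) • (Iic (1 : ℝ)).indicator id y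
      = 1 / (Module.finrank ℝ E + 1 : ℝ) := by
    have hpos : 0 < Module.finrank ℝ E := Module.finrank_pos
    have : ∀ y : ℝ, y ^ (Module.finrank ℝ E - 1) • (Iic (1 : ℝ)).indicator id y
        = (Iic (1 : ℝ)).indicator (fun y => y ^ Module.finrank ℝ E) y := by
      intro y
      simp only [indicator, id, smul_eq_mul, mem_Iic, mul_ite, mul_zero]
      rw [← pow_succ, Nat.sub_add_cancel hpos]
    simp_rw [this]
    rw [setIntegral_indicator measurableSet_Iic, Ioi_inter_Iic,
      ← intervalIntegral.integral_of_le zero_le_one, integral_pow]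
    simp
  rw [h1, h2] at h
  have hne : μ.real (ball (0 : E) 1) ≠ 0 :=
    (ENNReal.toReal_pos (measure_ball_pos μ 0 one_pos).ne' measure_ball_lt_top.ne).ne'
  rw [setAverage_eq, h, Measure.addHaar_real_closedBall_eq_addHaar_real_ball]
  simp only [smul_eq_mul, nsmul_eq_mul]
  field_simp

end SphereIntegration

/-! ### Functions with bounded Lipschitz gradients. -/

/-- The descent lemma for functions with a Lipschitz continuous gradient. -/
theorem le_add_inner_gradient_add_sq {E : Type*} [NormedAddCommGroup E] [InnerProductSpace ℝ E]
    [CompleteSpace E] {f : E → ℝ} {L : ℝ} (hf : Differentiable ℝ f)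
    (hL : ∀ x y, ‖gradient f x - gradient f y‖ ≤ L * ‖x - y‖) (x y : E) :
    f y ≤ f x + inner ℝ (gradient f x) (y - x) + L / 2 * ‖y - x‖ ^ 2 := by
  set v := y - x with hv
  set h : ℝ → ℝ := fun t => f (x + t • v) - t * inner ℝ (gradient f x) v
    - L / 2 * t ^ 2 * ‖v‖ ^ 2 with hh
  have hd : ∀ t : ℝ, HasDerivAt h (inner ℝ (gradient f (x + t • v)) v
      - inner ℝ (gradient f x) v - L * t * ‖v‖ ^ 2) t := by
    intro t
    have h0 : HasDerivAt (fun t : ℝ => x + t • v) v t := by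
      simpa using ((hasDerivAt_id t).smul_const v).const_add x
    have h1 : HasDerivAt (fun t : ℝ => f (x + t • v)) (inner ℝ (gradient f (x + t • v)) v) t := by
      rw [inner_gradient_left]
      exact (hf _).hasFDerivAt.comp_hasDerivAt t h0
    have h2 := (hasDerivAt_id t).mul_const (inner ℝ (gradient f x) v)
    have h3 := (((hasDerivAt_id t).pow 2).const_mul (L / 2)).mul_const (‖v‖ ^ 2)
    refine ((h1.sub h2).sub h3).congr_deriv ?_
    simp only [Nat.cast_ofNat, id, pow_one, Nat.add_one_sub_one, mul_one, one_mul]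
    ring
  -- `h` is `f` along the segment minus its linear part and the quadratic allowance, which grows at
  -- rate `L t ‖v‖²`. This is exactly what the Lipschitz bound permits the slope of `f` to gain.
  have hanti : AntitoneOn h (Set.Icc 0 1) := by
    refine antitoneOn_of_deriv_nonpos (convex_Icc _ _)
      (fun t _ => (hd t).continuousAt.continuousWithinAt)
      (fun t _ => (hd t).differentiableAt.differentiableWithinAt) fun t ht => ?_
    rw [interior_Icc] at ht
    rw [(hd t).deriv, ← inner_sub_left]
    have h4 := real_inner_le_norm (gradient f (x + t • v) - gradient f x) v
    have h5 := hL (x + t • v) x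
    rw [add_sub_cancel_left, norm_smul, Real.norm_eq_abs, abs_of_pos ht.1] at h5
    nlinarith [norm_nonneg v, mul_le_mul_of_nonneg_right h5 (norm_nonneg v)]
  have h6 := hanti (Set.left_mem_Icc.2 zero_le_one) (Set.right_mem_Icc.2 zero_le_one) zero_le_one
  simp only [hh, hv, one_smul, zero_smul, add_zero, add_sub_cancel] at h6
  linarith

namespace ZOAdaMM

/-- A differentiable function whose gradient is `L`-Lipschitz with entries bounded by `η`. -/
structure IsSmoothBounded {d : ℕ} (L η : ℝ) (f : Vec d → ℝ) : Prop where
  differentiable : Differentiable ℝ f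
  norm_gradient_sub_le : ∀ x y, ‖gradient f x - gradient f y‖ ≤ L * ‖x - y‖
  abs_gradient_le : ∀ x i, |gradient f x i| ≤ η

theorem norm_le_sqrt_mul_of_abs_le {d : ℕ} {η : ℝ} {v : Vec d} (h : ∀ i, |v i| ≤ η) :
    ‖v‖ ≤ √d * η := by
  rcases Nat.eq_zero_or_pos d with rfl | hd
  · simp [Subsingleton.elim v 0]
  have hη : 0 ≤ η := (abs_nonneg _).trans (h ⟨0, hd⟩)
  refine (sq_le_sq₀ (norm_nonneg _) (by positivity)).1 ?_
  rw [EuclideanSpace.real_norm_sq_eq, mul_pow, Real.sq_sqrt (Nat.cast_nonneg d)]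
  calc ∑ i, v i ^ 2 ≤ ∑ _i : Fin d, η ^ 2 :=
        Finset.sum_le_sum fun i _ => sq_le_sq' (abs_le.1 (h i)).1 (abs_le.1 (h i)).2
    _ = d * η ^ 2 := by simp

theorem abs_apply_le_linfNorm {d : ℕ} (v : Vec d) (i : Fin d) : |v i| ≤ linfNorm v :=
  norm_le_pi_norm (WithLp.ofLp v : Fin d → ℝ) i

namespace IsSmoothBounded

variable {d : ℕ} {L η : ℝ} {f : Vec d → ℝ}

theorem norm_gradient_le (hf : IsSmoothBounded L η f) (x : Vec d) :
    ‖gradient f x‖ ≤ √d * η :=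
  norm_le_sqrt_mul_of_abs_le (hf.abs_gradient_le x)

theorem lipschitzWith (hf : IsSmoothBounded L η f) : LipschitzWith (√d * η).toNNReal f := by
  refine lipschitzWith_of_nnnorm_fderiv_le hf.differentiable fun x => ?_
  rw [← toDual_gradient, ← NNReal.coe_le_coe, coe_nnnorm, LinearIsometryEquiv.norm_map]
  exact (hf.norm_gradient_le x).trans (Real.le_coe_toNNReal _)

theorem abs_sub_le (hf : IsSmoothBounded L η f) (x y : Vec d) :
    |f x - f y| ≤ √d * η * ‖x - y‖ := by
  have h := hf.lipschitzWith.dist_le_mul x y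
  rwa [Real.coe_toNNReal _ ((norm_nonneg _).trans (hf.norm_gradient_le x)), Real.dist_eq,
    dist_eq_norm] at h

theorem continuous_gradient (hf : IsSmoothBounded L η f) : Continuous (gradient f) := by
  have : LipschitzWith L.toNNReal (gradient f) := LipschitzWith.of_dist_le_mul fun x y => by
    rw [dist_eq_norm, dist_eq_norm]
    exact (hf.norm_gradient_sub_le x y).trans
      (mul_le_mul_of_nonneg_right (Real.le_coe_toNNReal _) (norm_nonneg _))
  exact this.continuous

theorem hasLineDerivAt (hf : IsSmoothBounded L η f) (x v : Vec d) :
    HasLineDerivAt ℝ f (inner ℝ (gradient f x) v) x v := by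
  rw [inner_gradient_left]
  exact (hf.differentiable x).hasFDerivAt.hasLineDerivAt v

end IsSmoothBounded

/-! ### Differentiation under the expectation. -/

section Objective

variable {d : ℕ} {L η : ℝ} {Ξ : Type*} [MeasurableSpace Ξ] {ν : Measure Ξ} {F : Ξ → Vec d → ℝ}

/-- Each coordinate is a pointwise limit of difference quotients with step `1/(n+1)`, which are
measurable in the sample. -/
theorem measurable_gradient_param (hF_meas : ∀ x, Measurable fun s => F s x)
    (hF : ∀ s, IsSmoothBounded L η (F s)) (x : Vec d) :
    Measurable fun s => gradient (F s) x := by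
  have hcoord : ∀ i, Measurable fun s => gradient (F s) x i := by
    intro i
    refine measurable_of_tendsto_metrizable (f := fun (n : ℕ) s =>
      ((n : ℝ) + 1) * (F s (x + ((n : ℝ) + 1)⁻¹ • EuclideanSpace.single i 1) - F s x)) ?_ ?_
    · intro n
      exact ((hF_meas _).sub (hF_meas x)).const_mul _
    · rw [tendsto_pi_nhds]
      intro s
      have h := ((hF s).hasLineDerivAt x (EuclideanSpace.single i 1)).tendsto_slope_zero
      have h2 : Filter.Tendsto (fun n : ℕ => ((n : ℝ) + 1)⁻¹) Filter.atTop
          (nhdsWithin 0 {0}ᶜ) := by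
        refine tendsto_nhdsWithin_iff.2 ⟨?_, .of_forall fun n => ?_⟩
        · simpa using tendsto_one_div_add_atTop_nhds_zero_nat (𝕜 := ℝ)
        · have : ((n : ℝ) + 1)⁻¹ ≠ 0 := by positivity
          simpa using this
      have h3 := h.comp h2
      rw [EuclideanSpace.inner_single_right] at h3
      simpa [Function.comp_def] using h3
  exact (WithLp.measurable_toLp 2 _).comp (measurable_pi_lambda _ hcoord)

variable [IsProbabilityMeasure ν]

/-- The common Lipschitz constant `√d * η` dominates all difference quotients, so derivative and
expectation commute. -/
theorem hasGradientAt_objective (hF_meas : ∀ x, Measurable fun s => F s x)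
    (hF_int : ∀ x, Integrable (fun s => F s x) ν) (hF : ∀ s, IsSmoothBounded L η (F s))
    (x : Vec d) :
    HasGradientAt (objective ν F) (∫ s, gradient (F s) x ∂ν) x := by
  have hm := (measurable_gradient_param hF_meas hF x)
  have hgi : Integrable (fun s => gradient (F s) x) ν :=
    .of_bound hm.aestronglyMeasurable (√d * η) (.of_forall fun s => (hF s).norm_gradient_le x)
  have h := (hasFDerivAt_integral_of_dominated_loc_of_lip' (μ := ν) (𝕜 := ℝ)
    (F := fun x s => F s x) (s := Set.univ) (x₀ := x) (bound := fun _ => √d * η)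
    (F' := fun s => InnerProductSpace.toDual ℝ (Vec d) (gradient (F s) x))
    Filter.univ_mem (fun y _ => (hF_meas y).aestronglyMeasurable) (hF_int x)
    ((InnerProductSpace.toDual ℝ (Vec d)).continuous.comp_aestronglyMeasurable
      hm.aestronglyMeasurable)
    (.of_forall fun s y _ => (hF s).abs_sub_le y x) (integrable_const _)
    (.of_forall fun s => ((hF s).differentiable x).hasGradientAt.hasFDerivAt)).2
  rw [hasGradientAt_iff_hasFDerivAt]
  have hdi : Integrable (fun s => InnerProductSpace.toDual ℝ (Vec d) (gradient (F s) x)) ν :=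
    .of_bound ((InnerProductSpace.toDual ℝ (Vec d)).continuous.comp_aestronglyMeasurable
      hm.aestronglyMeasurable) (√d * η) (.of_forall fun s => by
        rw [LinearIsometryEquiv.norm_map]; exact (hF s).norm_gradient_le x)
  refine h.congr_fderiv ?_
  ext v
  rw [ContinuousLinearMap.integral_apply hdi, InnerProductSpace.toDual_apply_apply,
    real_inner_comm, ← integral_inner hgi]
  simp

theorem isSmoothBounded_objective (hF_meas : ∀ x, Measurable fun s => F s x)
    (hF_int : ∀ x, Integrable (fun s => F s x) ν) (hF : ∀ s, IsSmoothBounded L η (F s)) :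
    IsSmoothBounded L η (objective ν F) := by
  have hg := hasGradientAt_objective hF_meas hF_int hF
  have hgi : ∀ x, Integrable (fun s => gradient (F s) x) ν := fun x =>
    .of_bound (measurable_gradient_param hF_meas hF x).aestronglyMeasurable (√d * η)
      (.of_forall fun s => (hF s).norm_gradient_le x)
  refine ⟨fun x => (hg x).differentiableAt, fun x y => ?_, fun x i => ?_⟩
  · rw [(hg x).gradient, (hg y).gradient, ← integral_sub (hgi x) (hgi y)]
    simpa using norm_integral_le_of_norm_le_const (μ := ν)
      (.of_forall fun s => (hF s).norm_gradient_sub_le x y)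
  · have hi : ∀ i, Integrable (fun s => gradient (F s) x i) ν := fun i =>
      .of_bound (((measurable_pi_apply i).comp (WithLp.measurable_ofLp 2 _)).comp
        (measurable_gradient_param hF_meas hF x)).aestronglyMeasurable η
        (.of_forall fun s => (hF s).abs_gradient_le x i)
    rw [(hg x).gradient, eval_integral_piLp hi]
    simpa using norm_integral_le_of_norm_le_const (μ := ν) (C := η)
      (f := fun s => gradient (F s) x i) (.of_forall fun s => (hF s).abs_gradient_le x i)

end Objective

end ZOAdaMM

/-! ### Smoothing over the ball and unbiasedness of the sphere estimate. -/

namespace ZOAdaMM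

/-- The uniform probability distribution on the closed unit ball. -/
noncomputable def ballUniform (d : ℕ) : Measure (Vec d) :=
  (volume.restrict (Metric.closedBall (0 : Vec d) 1) Set.univ)⁻¹ •
    volume.restrict (Metric.closedBall (0 : Vec d) 1)

instance (d : ℕ) : IsProbabilityMeasure (ballUniform d) := by
  refine ⟨?_⟩
  have h0 : (volume : Measure (Vec d)) (Metric.closedBall 0 1) ≠ 0 :=
    (Metric.measure_closedBall_pos volume _ one_pos).ne'
  simp only [ballUniform, Measure.smul_apply, smul_eq_mul, Measure.restrict_apply_univ]
  exact ENNReal.inv_mul_cancel h0 measure_closedBall_lt_top.ne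

theorem integral_ballUniform {d : ℕ} {E : Type*} [NormedAddCommGroup E] [NormedSpace ℝ E]
    (f : Vec d → E) :
    ∫ x, f x ∂ballUniform d = ⨍ x in Metric.closedBall (0 : Vec d) 1, f x := rfl

theorem integrable_ballUniform_of_continuous {d : ℕ} {E : Type*} [NormedAddCommGroup E]
    {f : Vec d → E} (hf : Continuous f) : Integrable f (ballUniform d) := by
  refine Integrable.smul_measure
    (hf.continuousOn.integrableOn_compact (isCompact_closedBall 0 1)) ?_
  rw [Measure.restrict_apply_univ]
  exact ENNReal.inv_ne_top.2 (Metric.measure_closedBall_pos volume _ one_pos).ne'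

theorem integral_ballUniform_norm {d : ℕ} (hd : 1 ≤ d) :
    ∫ x, ‖x‖ ∂ballUniform d = d / (d + 1 : ℝ) := by
  have : Nonempty (Fin d) := ⟨⟨0, hd⟩⟩
  rw [integral_ballUniform, setAverage_closedBall_norm]
  simp

/-- The average of the gradient of `f` over the ball of radius `μ` around `x`: the gradient of
`smoothing μ f` at `x`. -/
noncomputable def smoothGrad {d : ℕ} (μ : ℝ) (f : Vec d → ℝ) (x : Vec d) : Vec d :=
  ∫ u, gradient f (x + μ • u) ∂ballUniform d

namespace IsSmoothBounded

variable {d : ℕ} {L η μ : ℝ} {f : Vec d → ℝ}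

theorem integrable_gradient (hf : IsSmoothBounded L η f) (μ : ℝ) (x : Vec d) :
    Integrable (fun u => gradient f (x + μ • u)) (ballUniform d) :=
  integrable_ballUniform_of_continuous
    (hf.continuous_gradient.comp (by fun_prop : Continuous fun u : Vec d => x + μ • u))

theorem smoothGrad_apply (hf : IsSmoothBounded L η f) (μ : ℝ) (x : Vec d) (i : Fin d) :
    smoothGrad μ f x i = ∫ u, gradient f (x + μ • u) i ∂ballUniform d :=
  eval_integral_piLp (fun _ => integrable_piLp_iff.1 (hf.integrable_gradient μ x) _) i

theorem abs_smoothGrad_le (hf : IsSmoothBounded L η f) (μ : ℝ) (x : Vec d) (i : Fin d) :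
    |smoothGrad μ f x i| ≤ η := by
  rw [hf.smoothGrad_apply]
  simpa using norm_integral_le_of_norm_le_const (μ := ballUniform d) (C := η)
    (f := fun u => gradient f (x + μ • u) i) (.of_forall fun s => hf.abs_gradient_le _ i)

theorem norm_smoothGrad_sub_le (hf : IsSmoothBounded L η f) (μ : ℝ) (x y : Vec d) :
    ‖smoothGrad μ f x - smoothGrad μ f y‖ ≤ L * ‖x - y‖ := by
  unfold smoothGrad
  rw [← integral_sub (hf.integrable_gradient μ x) (hf.integrable_gradient μ y)]
  simpa using norm_integral_le_of_norm_le_const (μ := ballUniform d) (C := L * ‖x - y‖)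
    (f := fun u => gradient f (x + μ • u) - gradient f (y + μ • u))
    (.of_forall fun u => by simpa using hf.norm_gradient_sub_le (x + μ • u) (y + μ • u))

theorem continuous_smoothGrad (hf : IsSmoothBounded L η f) (μ : ℝ) :
    Continuous (smoothGrad μ f) := by
  have : LipschitzWith L.toNNReal (smoothGrad μ f) := LipschitzWith.of_dist_le_mul fun x y => by
    rw [dist_eq_norm, dist_eq_norm]
    exact (hf.norm_smoothGrad_sub_le μ x y).trans
      (mul_le_mul_of_nonneg_right (Real.le_coe_toNNReal _) (norm_nonneg _))
  exact this.continuous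

/-- The descent lemma is applied to each translate of `f` and then averaged. Thus `smoothGrad`
serves as the slope in the descent inequality without `smoothing` having to be differentiated. -/
theorem smoothing_le (hf : IsSmoothBounded L η f) (μ : ℝ) (x y : Vec d) :
    smoothing μ f y ≤ smoothing μ f x + inner ℝ (smoothGrad μ f x) (y - x)
      + L / 2 * ‖y - x‖ ^ 2 := by
  have hi : ∀ x, Integrable (fun u => f (x + μ • u)) (ballUniform d) := fun x =>
    integrable_ballUniform_of_continuous
      (hf.differentiable.continuous.comp (by fun_prop : Continuous fun u : Vec d => x + μ • u))
  have hg := hf.integrable_gradient μ x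
  have hgi : Integrable (fun u => inner ℝ (gradient f (x + μ • u)) (y - x)) (ballUniform d) :=
    hg.inner_const (y - x)
  have h : ∫ u, f (y + μ • u) ∂ballUniform d ≤ ∫ u, (f (x + μ • u)
      + inner ℝ (gradient f (x + μ • u)) (y - x) + L / 2 * ‖y - x‖ ^ 2) ∂ballUniform d := by
    refine integral_mono (hi y) (((hi x).add hgi).add (integrable_const _)) fun u => ?_
    have := le_add_inner_gradient_add_sq hf.differentiable hf.norm_gradient_sub_le
      (x + μ • u) (y + μ • u)
    rwa [add_sub_add_right_eq_sub] at this
  rw [integral_add (f := fun u => f (x + μ • u) + inner ℝ (gradient f (x + μ • u)) (y - x))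
    ((hi x).add hgi) (integrable_const _), integral_add (hi x) hgi, integral_const, probReal_univ, one_smul] at h
  have e : ∫ u, inner ℝ (gradient f (x + μ • u)) (y - x) ∂ballUniform d
      = inner ℝ (smoothGrad μ f x) (y - x) := by
    simp_rw [real_inner_comm (y - x)]
    exact integral_inner hg _
  rwa [e] at h

/-- The gradient moves by at most `L μ ‖u‖`, and the mean of `‖u‖` is `d/(d+1)`, which is at most
`d/2` because `d ≥ 1`. This weaker form is the one that yields the constant `L² / (2c)`. -/
theorem norm_gradient_sub_smoothGrad_le (hf : IsSmoothBounded L η f) (hd : 1 ≤ d) (hL : 0 ≤ L)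
    (hμ : 0 ≤ μ) (x : Vec d) :
    ‖gradient f x - smoothGrad μ f x‖ ≤ L * μ * d / 2 := by
  have e : gradient f x - smoothGrad μ f x
      = ∫ u, (gradient f x - gradient f (x + μ • u)) ∂ballUniform d := by
    rw [integral_sub (integrable_const _) (hf.integrable_gradient μ x)]
    simp [smoothGrad]
  rw [e]
  have hn : Integrable (fun u : Vec d => L * μ * ‖u‖) (ballUniform d) :=
    integrable_ballUniform_of_continuous (by fun_prop)
  calc _ ≤ ∫ u, L * μ * ‖u‖ ∂ballUniform d :=
        norm_integral_le_of_norm_le hn (.of_forall fun u => by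
          refine (hf.norm_gradient_sub_le _ _).trans_eq ?_
          rw [sub_add_cancel_left, norm_neg, norm_smul, Real.norm_of_nonneg hμ, mul_assoc])
    _ = L * μ * (d / (d + 1 : ℝ)) := by rw [integral_const_mul, integral_ballUniform_norm hd]
    _ ≤ L * μ * (d / 2) := by
        have : (1 : ℝ) ≤ d := by exact_mod_cast hd
        gcongr
        linarith
    _ = L * μ * d / 2 := by ring

/-- The two-point gradient estimate is an unbiased estimate of the smoothed gradient. -/
theorem integral_zoGrad (hf : IsSmoothBounded L η f) (hd : 1 ≤ d) (hμ : μ ≠ 0) (x : Vec d)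
    (i : Fin d) :
    ∫ u, zoGrad μ f (u : Metric.sphere (0 : Vec d) 1) x i ∂sphereUniform d
      = smoothGrad μ f x i := by
  have : Nonempty (Fin d) := ⟨⟨0, hd⟩⟩
  set g : Vec d → ℝ := fun y => f (x + μ • y) - f x with hg
  have hgl : LipschitzWith ((√d * η).toNNReal * ‖μ‖₊) g := by
    have h1 : LipschitzWith ‖μ‖₊ fun y : Vec d => x + μ • y :=
      LipschitzWith.of_dist_le_mul fun y z => by simp [dist_smul₀]
    have h2 := (hf.lipschitzWith.comp h1).sub (LipschitzWith.const (f x))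
    rwa [add_zero] at h2
  have hd1 : ∀ y, lineDeriv ℝ g y (EuclideanSpace.single i 1) = μ * gradient f (x + μ • y) i := by
    intro y
    have h1 := hf.hasLineDerivAt (x + μ • y) (μ • EuclideanSpace.single i 1)
    have h2 : HasLineDerivAt ℝ g (μ * gradient f (x + μ • y) i) y
        (EuclideanSpace.single i 1) := by
      unfold HasLineDerivAt at h1 ⊢
      refine ((h1.sub_const (f x)).congr_deriv ?_).congr_of_eventuallyEq (.of_forall fun t => ?_)
      · rw [inner_smul_right, EuclideanSpace.inner_single_right]
        simp
      · simp only [hg, smul_add, smul_comm t μ, add_assoc]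
    exact h2.lineDeriv
  have hpc : Continuous fun y => μ * gradient f (x + μ • y) i := by
    have := hf.continuous_gradient
    fun_prop
  -- The direction is the `i`-th basis vector, so the normal component on the sphere is `u i`, the
  -- factor present in the estimate.
  have hdiv := setIntegral_ball_lineDeriv_eq_integral_toSphere (volume : Measure (Vec d)) hgl hpc
    (EuclideanSpace.single i 1) hd1
  have hae : Metric.ball (0 : Vec d) 1 =ᵐ[volume] Metric.closedBall (0 : Vec d) 1 :=
    ae_eq_of_subset_of_measure_ge Metric.ball_subset_closedBall
      (Measure.addHaar_closedBall_eq_addHaar_ball volume _ _).le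
      measurableSet_ball.nullMeasurableSet measure_closedBall_lt_top.ne
  rw [integral_const_mul, setIntegral_congr_set hae] at hdiv
  have hz : ∀ u : Metric.sphere (0 : Vec d) 1, zoGrad μ f u x i
      = d / μ * (g u * inner ℝ (u : Vec d) (EuclideanSpace.single i 1)) := by
    intro u
    rw [EuclideanSpace.inner_single_right]
    simp [zoGrad, hg, mul_assoc]
  have hne : (volume : Measure (Vec d)).real (Metric.ball 0 1) ≠ 0 :=
    (ENNReal.toReal_pos (Metric.measure_ball_pos volume 0 one_pos).ne' measure_ball_lt_top.ne).ne'
  have hd0 : (d : ℝ) ≠ 0 := by positivity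
  -- The sphere has area `d` times the volume of the ball. This explains the factor `d` in the
  -- estimate: it converts the sphere average into a ball average.
  have htop : ((volume : Measure (Vec d)).toSphere Set.univ)⁻¹.toReal
      = (d * (volume : Measure (Vec d)).real (Metric.ball 0 1))⁻¹ := by
    rw [ENNReal.toReal_inv, ← measureReal_def, Measure.toSphere_real_apply_univ]
    simp
  simp_rw [hz]
  rw [hf.smoothGrad_apply, integral_ballUniform, setAverage_eq, integral_const_mul, sphereUniform,
    integral_smul_measure, ← hdiv, htop, Measure.addHaar_real_closedBall_eq_addHaar_real_ball]
  simp only [smul_eq_mul]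
  field_simp

end IsSmoothBounded

end ZOAdaMM

/-! ### Boundedness, measurability and mean of the gradient estimate. -/

namespace ZOAdaMM

theorem isProbabilityMeasure_sphereUniform {d : ℕ} (hd : 1 ≤ d) :
    IsProbabilityMeasure (sphereUniform d) := by
  have : Nonempty (Fin d) := ⟨⟨0, hd⟩⟩
  refine ⟨?_⟩
  simp only [sphereUniform, Measure.smul_apply, smul_eq_mul]
  refine ENNReal.inv_mul_cancel ?_ (measure_ne_top _ _)
  rw [ne_eq, Measure.measure_univ_eq_zero]
  exact Measure.toSphere_ne_zero _

/-- The Lipschitz bound cancels the division by `μ`. The resulting deterministic bound is crude and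
serves only to make everything integrable; it does not enter the rate. -/
theorem IsSmoothBounded.abs_zoGrad_le {d : ℕ} {L η μ : ℝ} {f : Vec d → ℝ}
    (hf : IsSmoothBounded L η f) (hμ : 0 < μ) (u : Metric.sphere (0 : Vec d) 1) (x : Vec d)
    (i : Fin d) : |zoGrad μ f u x i| ≤ d * (√d * η) := by
  have h1 := hf.abs_sub_le (x + μ • (u : Vec d)) x
  rw [add_sub_cancel_left, norm_smul, norm_eq_of_mem_sphere, mul_one,
    Real.norm_of_nonneg hμ.le] at h1
  have h2 : |(u : Vec d) i| ≤ 1 := by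
    simpa using PiLp.norm_apply_le (u : Vec d) i
  have h3 : zoGrad μ f u x i
      = d / μ * (f (x + μ • (u : Vec d)) - f x) * (u : Vec d) i := by
    simp [zoGrad]
  rw [h3, abs_mul, abs_mul, abs_of_nonneg (by positivity : 0 ≤ (d : ℝ) / μ)]
  calc (d : ℝ) / μ * |f (x + μ • (u : Vec d)) - f x| * |(u : Vec d) i|
      ≤ d / μ * (√d * η * μ) * 1 := by
        have := (abs_nonneg _).trans h1
        gcongr
    _ = d * (√d * η) := by field_simp

section Measurability

variable {d : ℕ} {L η : ℝ} {Ξ : Type*} [MeasurableSpace Ξ] {ν : Measure Ξ} {F : Ξ → Vec d → ℝ}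

theorem measurable_uncurry_of_isSmoothBounded (hF_meas : ∀ x, Measurable fun s => F s x)
    (hF : ∀ s, IsSmoothBounded L η (F s)) :
    Measurable fun p : Ξ × Vec d => F p.1 p.2 :=
  (measurable_uncurry_of_continuous_of_measurable (u := fun x s => F s x)
    (fun s => (hF s).differentiable.continuous) hF_meas).comp measurable_swap

theorem measurable_zoGrad (hF_meas : ∀ x, Measurable fun s => F s x)
    (hF : ∀ s, IsSmoothBounded L η (F s)) (μ : ℝ) :
    Measurable fun p : Vec d × (Ξ × Metric.sphere (0 : Vec d) 1) =>
      zoGrad μ (F p.2.1) p.2.2 p.1 := by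
  have h := measurable_uncurry_of_isSmoothBounded hF_meas hF
  have h1 : Measurable fun p : Vec d × (Ξ × Metric.sphere (0 : Vec d) 1) =>
      F p.2.1 (p.1 + μ • (p.2.2 : Vec d)) :=
    h.comp (by fun_prop : Measurable fun p : Vec d × (Ξ × Metric.sphere (0 : Vec d) 1) =>
      (p.2.1, p.1 + μ • (p.2.2 : Vec d)))
  have h2 : Measurable fun p : Vec d × (Ξ × Metric.sphere (0 : Vec d) 1) =>
      F p.2.1 p.1 :=
    h.comp (by fun_prop : Measurable fun p : Vec d × (Ξ × Metric.sphere (0 : Vec d) 1) =>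
      (p.2.1, p.1))
  unfold zoGrad
  fun_prop

theorem measurable_apply_vec (i : Fin d) : Measurable fun v : Vec d => v i := by fun_prop

/-- The estimate is linear in the function, so integrating over the sample first gives the estimate
for the objective itself, whose sphere mean is known. -/
theorem integral_prod_zoGrad [IsProbabilityMeasure ν] (hd : 1 ≤ d)
    (hF_meas : ∀ x, Measurable fun s => F s x) (hF_int : ∀ x, Integrable (fun s => F s x) ν)
    (hF : ∀ s, IsSmoothBounded L η (F s)) {μ : ℝ} (hμ : 0 < μ) (x : Vec d) (i : Fin d) :
    ∫ p : Ξ × Metric.sphere (0 : Vec d) 1, zoGrad μ (F p.1) p.2 x i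
      ∂ν.prod (sphereUniform d) = smoothGrad μ (objective ν F) x i := by
  have := isProbabilityMeasure_sphereUniform hd
  have hm : Measurable fun p : Ξ × Metric.sphere (0 : Vec d) 1 => zoGrad μ (F p.1) p.2 x i :=
    (measurable_apply_vec i).comp ((measurable_zoGrad hF_meas hF μ).comp measurable_prodMk_left)
  rw [integral_prod_symm _ (.of_bound hm.aestronglyMeasurable (d * (√d * η))
      (.of_forall fun p => (hF p.1).abs_zoGrad_le hμ p.2 x i)),
    ← (isSmoothBounded_objective hF_meas hF_int hF).integral_zoGrad hd hμ.ne']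
  refine integral_congr_ae (.of_forall fun u => ?_)
  simp only [zoGrad, objective, PiLp.smul_apply, smul_eq_mul]
  rw [integral_mul_const, integral_const_mul, integral_sub (hF_int _) (hF_int _)]

end Measurability

end ZOAdaMM

/-! ### One iteration: invariants and descent of the auxiliary point. -/

namespace ZOAdaMM

/-- The properties of the variables of the algorithm that all iterations preserve. -/
structure IsAdmissible {d : ℕ} (c β₁ β₂ : ℝ) (S : State d) : Prop where
  le_sqrt_vhat : ∀ i, c ≤ √(S.vhat i)
  v_nonneg : ∀ i, 0 ≤ S.v i
  v_le_vhat : ∀ i, S.v i ≤ S.vhat i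
  sq_m_le : ∀ i, (1 - β₁ ^ 2 / β₂) * (1 - β₂) * S.m i ^ 2 ≤ (1 - β₁) ^ 2 * S.v i

/-- The auxiliary point `x_{t+1} + β₁ / (1 - β₁) (x_{t+1} - x_t)`, written in terms of
`x_{t+1}`, `m_t` and `v̂_t`. -/
noncomputable def extrapolate {d : ℕ} (α β₁ : ℝ) (S : State d) : Vec d :=
  S.x - (α * (β₁ / (1 - β₁))) • WithLp.toLp 2 fun i => (√(S.vhat i))⁻¹ * S.m i

section Step

variable {d : ℕ} {c β₁ β₂ : ℝ}

/-- Cauchy–Schwarz with weights `θ = β₁²/β₂` and `1 - θ`, chosen so that the old momentum is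
discounted by exactly `β₂`, the rate of the recursion for `v`. After multiplication by `β₂` the
defect is a perfect square. -/
theorem sq_momentum_le {m g : ℝ} (hβ₂ : 0 < β₂) :
    (1 - β₁ ^ 2 / β₂) * (β₁ * m + (1 - β₁) * g) ^ 2
      ≤ (1 - β₁ ^ 2 / β₂) * β₂ * m ^ 2 + (1 - β₁) ^ 2 * g ^ 2 := by
  set θ := β₁ ^ 2 / β₂ with hθ'
  have h : β₁ ^ 2 = θ * β₂ := by rw [hθ']; field_simp
  have key : β₂ * ((1 - θ) * β₂ * m ^ 2 + (1 - β₁) ^ 2 * g ^ 2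
      - (1 - θ) * (β₁ * m + (1 - β₁) * g) ^ 2)
      = ((1 - θ) * β₂ * m - β₁ * ((1 - β₁) * g)) ^ 2 := by
    linear_combination (-(((1 - β₁) * g) ^ 2) - (1 - θ) * β₂ * m ^ 2) * h
  have := nonneg_of_mul_nonneg_right (key ▸ sq_nonneg _) hβ₂
  linarith

theorem IsAdmissible.step {S : State d} (hS : IsAdmissible c β₁ β₂ S) (α : ℝ) (g : Vec d)
    (hβ₂ : 0 < β₂) (hβ₂' : β₂ < 1) :
    IsAdmissible c β₁ β₂ (step α β₁ β₂ g S) where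
  le_sqrt_vhat i := (hS.le_sqrt_vhat i).trans (Real.sqrt_le_sqrt (le_max_left _ _))
  v_nonneg i := add_nonneg (mul_nonneg hβ₂.le (hS.v_nonneg i))
    (mul_nonneg (sub_nonneg.2 hβ₂'.le) (sq_nonneg _))
  v_le_vhat i := le_max_right _ _
  sq_m_le i := by
    have h1 := mul_le_mul_of_nonneg_left (sq_momentum_le (β₁ := β₁) (m := S.m i) (g := g i) hβ₂)
      (sub_nonneg.2 hβ₂'.le)
    have h2 := mul_le_mul_of_nonneg_left (hS.sq_m_le i) hβ₂.le
    simp only [ZOAdaMM.step, PiLp.add_apply, PiLp.smul_apply, smul_eq_mul]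
    linarith

theorem IsAdmissible.vhat_pos {S : State d} (hS : IsAdmissible c β₁ β₂ S) (hc : 0 < c)
    (i : Fin d) : 0 < S.vhat i :=
  Real.sqrt_pos.1 (hc.trans_le (hS.le_sqrt_vhat i))

/-- The invariant compares `m²` with `v ≤ v̂`, so dividing by `v̂` leaves a bound free of the size
of the gradients. -/
theorem IsAdmissible.sq_precond_mul_m_le {S : State d} (hS : IsAdmissible c β₁ β₂ S)
    (hc : 0 < c) (hβ₂' : β₂ < 1) (hθ : β₁ ^ 2 / β₂ < 1) (i : Fin d) :
    ((√(S.vhat i))⁻¹ * S.m i) ^ 2 ≤ (1 - β₁) ^ 2 / ((1 - β₁ ^ 2 / β₂) * (1 - β₂)) := by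
  have hp := hS.vhat_pos hc i
  have h1 : 0 < (1 - β₁ ^ 2 / β₂) * (1 - β₂) := mul_pos (sub_pos.2 hθ) (sub_pos.2 hβ₂')
  rw [mul_pow, inv_pow, Real.sq_sqrt hp.le, le_div_iff₀ h1, mul_assoc, inv_mul_le_iff₀ hp]
  have h2 := hS.sq_m_le i
  have h3 := mul_le_mul_of_nonneg_left (hS.v_le_vhat i) (sq_nonneg (1 - β₁))
  linarith

theorem IsAdmissible.sq_precond_step_mul_le {S : State d} (hS : IsAdmissible c β₁ β₂ S)
    (hc : 0 < c) (hβ₂ : 0 < β₂) (hβ₂' : β₂ < 1) (α : ℝ) (g : Vec d)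
    (i : Fin d) :
    ((√((ZOAdaMM.step α β₁ β₂ g S).vhat i))⁻¹ * g i) ^ 2 ≤ 1 / (1 - β₂) := by
  have hp := (hS.step α g hβ₂ hβ₂').vhat_pos hc i
  have h1 := (hS.step α g hβ₂ hβ₂').v_le_vhat i
  rw [mul_pow, inv_pow, Real.sq_sqrt hp.le, le_div_iff₀ (sub_pos.2 hβ₂'), mul_assoc,
    inv_mul_le_iff₀ hp]
  refine le_trans ?_ (h1.trans_eq (mul_one _).symm)
  have := mul_nonneg hβ₂.le (hS.v_nonneg i)
  simp only [ZOAdaMM.step]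
  linarith

theorem norm_sq_le_of_sq_le {v : Vec d} {C : ℝ} (h : ∀ i, v i ^ 2 ≤ C) : ‖v‖ ^ 2 ≤ d * C := by
  rw [EuclideanSpace.real_norm_sq_eq]
  calc ∑ i, v i ^ 2 ≤ ∑ _i : Fin d, C := Finset.sum_le_sum fun i _ => h i
    _ = d * C := by simp

/-- The change of a smooth function along one step of the auxiliary sequence. -/
theorem IsAdmissible.apply_extrapolate_step_le {S : State d} (hS : IsAdmissible c β₁ β₂ S)
    {φ : Vec d → ℝ} {Gφ : Vec d → Vec d} {L η α Γ : ℝ} (hL : 0 ≤ L)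
    (hφ : ∀ x y, φ y ≤ φ x + inner ℝ (Gφ x) (y - x) + L / 2 * ‖y - x‖ ^ 2)
    (hGL : ∀ x y, ‖Gφ x - Gφ y‖ ≤ L * ‖x - y‖) (hGη : ∀ x i, |Gφ x i| ≤ η)
    (hc : 0 < c) (hβ₁ : 0 ≤ β₁) (hβ₁' : β₁ < 1) (hβ₂ : 0 < β₂) (hβ₂' : β₂ < 1)
    (hθ : β₁ ^ 2 / β₂ < 1) (hα : 0 ≤ α) (g : Vec d) (hg : ∀ i, |g i| ≤ Γ)
    (hm : ∀ i, |S.m i| ≤ Γ) :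
    φ (extrapolate α β₁ (ZOAdaMM.step α β₁ β₂ g S)) ≤ φ (extrapolate α β₁ S)
      - α * ∑ i, Gφ S.x i * ((√(S.vhat i))⁻¹ * g i)
      + α * (η * Γ / (1 - β₁)) * ∑ i, ((√(S.vhat i))⁻¹
        - (√((ZOAdaMM.step α β₁ β₂ g S).vhat i))⁻¹)
      + L * α ^ 2 * (d * ((5 / 2 * (β₁ ^ 2 / (1 - β₁ ^ 2 / β₂)) + 1) / (1 - β₂))) := by
  set S' := ZOAdaMM.step α β₁ β₂ g S with hS'
  have hS2 : IsAdmissible c β₁ β₂ S' := hS.step α g hβ₂ hβ₂'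
  set D : Fin d → ℝ := fun i => (√(S.vhat i))⁻¹ with hD
  set D' : Fin d → ℝ := fun i => (√(S'.vhat i))⁻¹ with hD'
  set b := β₁ / (1 - β₁) with hb
  have h1β : 0 < 1 - β₁ := sub_pos.2 hβ₁'
  have hb0 : 0 ≤ b := div_nonneg hβ₁ h1β.le
  have hDD : ∀ i, D' i ≤ D i := fun i =>
    inv_anti₀ (hc.trans_le (hS.le_sqrt_vhat i)) (Real.sqrt_le_sqrt (le_max_left _ _))
  have hD0 : ∀ i, 0 ≤ D' i := fun i => inv_nonneg.2 (Real.sqrt_nonneg _)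
  set dg : Vec d := WithLp.toLp 2 fun i => D' i * g i with hdg
  set dm : Vec d := WithLp.toLp 2 fun i => D i * S.m i with hdm
  set w : Vec d := WithLp.toLp 2 fun i => (D' i - D i) * S.m i with hw
  set z := extrapolate α β₁ S with hz
  set z' := extrapolate α β₁ S' with hz'
  -- The weight `b = β₁/(1-β₁)` satisfies `(1 + b)(1 - β₁) = 1` and `(1 + b) β₁ = b`: the estimate
  -- gets weight one and the momentum cancels up to the change of preconditioner.
  have hzz : z' - z = -(α • dg) - (α * b) • w := by
    ext i
    have e : S'.x i = S.x i - α * (S'.m i / √(S'.vhat i)) := rfl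
    have e2 : S'.m i = β₁ * S.m i + (1 - β₁) * g i := rfl
    simp only [hz, hz', extrapolate, PiLp.sub_apply, PiLp.smul_apply, PiLp.neg_apply, hdg, hw,
      smul_eq_mul, hD, hD', e, e2, div_eq_mul_inv (_ + _), hb]
    field_simp
    ring
  have hzx : z - S.x = -((α * b) • dm) := by
    simp [hz, extrapolate, hdm, hD, hb]
  -- Since `0 ≤ D' ≤ D`, the change `D' - D` is no larger than `D` in absolute value.
  have hwdm : ‖w‖ ≤ ‖dm‖ := by
    refine (sq_le_sq₀ (norm_nonneg _) (norm_nonneg _)).1 ?_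
    rw [EuclideanSpace.real_norm_sq_eq, EuclideanSpace.real_norm_sq_eq]
    refine Finset.sum_le_sum fun i _ => ?_
    simp only [hw, hdm, mul_pow]
    refine mul_le_mul_of_nonneg_right ?_ (sq_nonneg _)
    nlinarith [hDD i, hD0 i]
  have hdg2 : ‖dg‖ ^ 2 ≤ d * (1 / (1 - β₂)) :=
    norm_sq_le_of_sq_le (hS.sq_precond_step_mul_le hc hβ₂ hβ₂' α g)
  have hdm2 : ‖dm‖ ^ 2 ≤ d * ((1 - β₁) ^ 2 / ((1 - β₁ ^ 2 / β₂) * (1 - β₂))) :=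
    norm_sq_le_of_sq_le (hS.sq_precond_mul_m_le hc hβ₂' hθ)
  have hn1 : ‖z' - z‖ ≤ α * (‖dg‖ + b * ‖dm‖) := by
    rw [hzz]
    refine (norm_sub_le _ _).trans ?_
    rw [norm_neg, norm_smul, norm_smul, Real.norm_of_nonneg hα,
      Real.norm_of_nonneg (mul_nonneg hα hb0)]
    nlinarith [mul_le_mul_of_nonneg_left hwdm (mul_nonneg hα hb0)]
  have hn2 : ‖z - S.x‖ = α * (b * ‖dm‖) := by
    rw [hzx, norm_neg, norm_smul, Real.norm_of_nonneg (mul_nonneg hα hb0), mul_assoc]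
  -- The price of replacing `D'` by the lagged `D` (weight `1`) and the drift `w` (weight `b`) are
  -- both at most `η * Γ` times `D - D'`. Together they give the factor `1 + b = 1/(1 - β₁)`.
  have hinner : inner ℝ (Gφ z) (z' - z) ≤ -(α * inner ℝ (Gφ z - Gφ S.x) dg)
      - α * ∑ i, Gφ S.x i * (D i * g i) + α * (η * Γ / (1 - β₁)) * ∑ i, (D i - D' i) := by
    rw [hzz, PiLp.inner_apply, PiLp.inner_apply, Finset.mul_sum, Finset.mul_sum, Finset.mul_sum,
      ← Finset.sum_neg_distrib, ← Finset.sum_sub_distrib, ← Finset.sum_add_distrib]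
    refine Finset.sum_le_sum fun i _ => ?_
    simp only [RCLike.inner_apply, conj_trivial, PiLp.sub_apply, PiLp.neg_apply, PiLp.smul_apply,
      smul_eq_mul, hdg, hw]
    have hη : 0 ≤ η := (abs_nonneg _).trans (hGη z i)
    have a1 : Gφ S.x i * g i ≤ η * Γ := by
      refine (le_abs_self _).trans ?_
      rw [abs_mul]
      exact mul_le_mul (hGη _ _) (hg i) (abs_nonneg _) hη
    have a2 : Gφ z i * S.m i ≤ η * Γ := by
      refine (le_abs_self _).trans ?_
      rw [abs_mul]
      exact mul_le_mul (hGη _ _) (hm i) (abs_nonneg _) hη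
    have a3 := mul_le_mul_of_nonneg_left a1 (mul_nonneg hα (sub_nonneg.2 (hDD i)))
    have a4 := mul_le_mul_of_nonneg_left a2
      (mul_nonneg (mul_nonneg hα hb0) (sub_nonneg.2 (hDD i)))
    have a5 : η * Γ / (1 - β₁) = (1 + b) * (η * Γ) := by
      rw [hb]; field_simp; ring
    rw [a5]
    linarith
  have hcs : -(α * inner ℝ (Gφ z - Gφ S.x) dg) ≤ L * α ^ 2 * (b * ‖dm‖ * ‖dg‖) := by
    have b1 := abs_real_inner_le_norm (Gφ z - Gφ S.x) dg
    have b2 := hGL z S.x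
    rw [hn2] at b2
    have b3 := mul_le_mul_of_nonneg_right b2 (norm_nonneg dg)
    have b4 := mul_le_mul_of_nonneg_left ((neg_le_abs _).trans (b1.trans b3)) hα
    linarith
  have hquad : L / 2 * ‖z' - z‖ ^ 2 ≤ L * α ^ 2 * ((‖dg‖ + b * ‖dm‖) ^ 2 / 2) := by
    have := pow_le_pow_left₀ (norm_nonneg _) hn1 2
    have := mul_le_mul_of_nonneg_left this (div_nonneg hL zero_le_two)
    linarith
  -- With `p = b * ‖dm‖` and `q = ‖dg‖`, the inequality `p q + (p + q)²/2 ≤ 5/2 p² + q²` is `2 (p -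
  -- q/2)² ≥ 0`; hence the constant `5/2`.
  have hfin : b * ‖dm‖ * ‖dg‖ + (‖dg‖ + b * ‖dm‖) ^ 2 / 2
      ≤ d * ((5 / 2 * (β₁ ^ 2 / (1 - β₁ ^ 2 / β₂)) + 1) / (1 - β₂)) := by
    have e1 : b ^ 2 * (d * ((1 - β₁) ^ 2 / ((1 - β₁ ^ 2 / β₂) * (1 - β₂))))
        = d * (β₁ ^ 2 / (1 - β₁ ^ 2 / β₂) / (1 - β₂)) := by
      have : 1 - β₁ ^ 2 / β₂ ≠ 0 := (sub_pos.2 hθ).ne'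
      have : 1 - β₂ ≠ 0 := (sub_pos.2 hβ₂').ne'
      rw [hb]
      field_simp
    have e2 := mul_le_mul_of_nonneg_left hdm2 (sq_nonneg b)
    rw [e1] at e2
    have e3 : d * ((5 / 2 * (β₁ ^ 2 / (1 - β₁ ^ 2 / β₂)) + 1) / (1 - β₂))
        = 5 / 2 * (d * (β₁ ^ 2 / (1 - β₁ ^ 2 / β₂) / (1 - β₂))) + d * (1 / (1 - β₂)) := by
      ring
    rw [e3]
    nlinarith [sq_nonneg (b * ‖dm‖ - ‖dg‖ / 2)]
  have hfin' := mul_le_mul_of_nonneg_left hfin (mul_nonneg hL (sq_nonneg α))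
  have := hφ z z'
  linarith

end Step

end ZOAdaMM

/-! ### Summation along a trajectory. -/

namespace ZOAdaMM

section Trajectory

variable {d : ℕ} {c α β₁ β₂ : ℝ} {S : ℕ → State d} {g : ℕ → Vec d}

theorem isAdmissible_of_step (hS0 : IsAdmissible c β₁ β₂ (S 0))
    (hS : ∀ t, S (t + 1) = step α β₁ β₂ (g (t + 1)) (S t))
    (hβ₂ : 0 < β₂) (hβ₂' : β₂ < 1) (t : ℕ) : IsAdmissible c β₁ β₂ (S t) := by
  induction t with
  | zero => exact hS0
  | succ t ih => rw [hS]; exact ih.step α _ hβ₂ hβ₂'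

theorem abs_momentum_le (hS : ∀ t, S (t + 1) = step α β₁ β₂ (g (t + 1)) (S t))
    (hm0 : (S 0).m = 0) (hβ₁ : 0 ≤ β₁) (hβ₁' : β₁ < 1) {Γ : ℝ} (hΓ : 0 ≤ Γ) (T : ℕ)
    (hg : ∀ t < T, ∀ i, |g (t + 1) i| ≤ Γ) (t : ℕ) (ht : t ≤ T) (i : Fin d) :
    |(S t).m i| ≤ Γ := by
  induction t with
  | zero => simpa [hm0] using hΓ
  | succ t ih =>
    rw [hS]
    simp only [step, PiLp.add_apply, PiLp.smul_apply, smul_eq_mul]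
    refine (abs_add_le _ _).trans ?_
    rw [abs_mul, abs_mul, abs_of_nonneg hβ₁, abs_of_pos (sub_pos.2 hβ₁')]
    have h1 := mul_le_mul_of_nonneg_left (ih (by omega)) hβ₁
    have h2 := mul_le_mul_of_nonneg_left (hg t (by omega) i) (sub_pos.2 hβ₁').le
    linarith

/-- The pathwise bound obtained by summing the change of a smooth function along the auxiliary
sequence. -/
theorem sum_inner_precond_le (hS0 : IsAdmissible c β₁ β₂ (S 0)) (hm0 : (S 0).m = 0)
    (hS : ∀ t, S (t + 1) = step α β₁ β₂ (g (t + 1)) (S t))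
    {φ : Vec d → ℝ} {Gφ : Vec d → Vec d} {L η Γ Δ : ℝ} (hL : 0 ≤ L) (hη : 0 ≤ η)
    (hφ : ∀ x y, φ y ≤ φ x + inner ℝ (Gφ x) (y - x) + L / 2 * ‖y - x‖ ^ 2)
    (hGL : ∀ x y, ‖Gφ x - Gφ y‖ ≤ L * ‖x - y‖) (hGη : ∀ x i, |Gφ x i| ≤ η)
    (hc : 0 < c) (hβ₁ : 0 ≤ β₁) (hβ₁' : β₁ < 1) (hβ₂ : 0 < β₂) (hβ₂' : β₂ < 1)
    (hθ : β₁ ^ 2 / β₂ < 1) (hα : 0 ≤ α) (hΓ : 0 ≤ Γ) (T : ℕ)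
    (hg : ∀ t < T, ∀ i, |g (t + 1) i| ≤ Γ) (hΔ : ∀ x, φ (S 0).x - φ x ≤ Δ) :
    α * ∑ t ∈ Finset.range T, ∑ i, Gφ (S t).x i * ((√((S t).vhat i))⁻¹ * g (t + 1) i)
      ≤ Δ + α * (η * Γ / (1 - β₁)) * (d / c)
        + T * (L * α ^ 2 * (d * ((5 / 2 * (β₁ ^ 2 / (1 - β₁ ^ 2 / β₂)) + 1) / (1 - β₂)))) := by
  have hadm := isAdmissible_of_step hS0 hS hβ₂ hβ₂'
  have hm := abs_momentum_le hS hm0 hβ₁ hβ₁' hΓ T hg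
  set K := L * α ^ 2 * (d * ((5 / 2 * (β₁ ^ 2 / (1 - β₁ ^ 2 / β₂)) + 1) / (1 - β₂))) with hK
  -- The preconditioner changes telescope to the difference between time `0` and time `n`. The
  -- sequence starts at `x₁` because the initial momentum vanishes.
  have key : ∀ n ≤ T, φ (extrapolate α β₁ (S n)) ≤ φ (S 0).x
      - α * ∑ t ∈ Finset.range n, ∑ i, Gφ (S t).x i * ((√((S t).vhat i))⁻¹ * g (t + 1) i)
      + α * (η * Γ / (1 - β₁)) * ∑ i, ((√((S 0).vhat i))⁻¹ - (√((S n).vhat i))⁻¹) + n * K := by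
    intro n
    induction n with
    | zero =>
      intro _
      have : extrapolate α β₁ (S 0) = (S 0).x := by
        ext i
        simp [extrapolate, hm0]
      simp [this]
    | succ n ih =>
      intro hn
      have h1 := ih (by omega)
      have h2 := (hadm n).apply_extrapolate_step_le hL hφ hGL hGη hc hβ₁ hβ₁' hβ₂ hβ₂' hθ hα
        (g (n + 1)) (hg n (by omega)) (hm n (by omega))
      rw [← hS, ← hK] at h2
      rw [Finset.sum_range_succ]
      rw [Finset.sum_sub_distrib] at h1 h2 ⊢
      push_cast
      linarith
  have h1 := key T le_rfl
  have h2 := hΔ (extrapolate α β₁ (S T))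
  have h3 : ∑ i, ((√((S 0).vhat i))⁻¹ - (√((S T).vhat i))⁻¹) ≤ d / c := by
    calc _ ≤ ∑ _i : Fin d, c⁻¹ := Finset.sum_le_sum fun i _ => by
          have e1 := inv_anti₀ hc (hS0.le_sqrt_vhat i)
          have e2 : 0 ≤ (√((S T).vhat i))⁻¹ := by positivity
          linarith
      _ = d / c := by simp [div_eq_mul_inv]
  have h4 : 0 ≤ α * (η * Γ / (1 - β₁)) := by
    have := sub_pos.2 hβ₁'
    positivity
  have h5 := mul_le_mul_of_nonneg_left h3 h4
  linarith

end Trajectory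

/-! ### The convergence measure and the numerical constant. -/

section Mahalanobis

variable {d : ℕ} {c : ℝ}

theorem mahalanobisSq_eq_sum {v : Vec d} (hv : ∀ i, 0 < v i) (g : Vec d) :
    mahalanobisSq v g = ∑ i, (√(v i))⁻¹ * g i ^ 2 := by
  rw [mahalanobisSq, EuclideanSpace.real_norm_sq_eq]
  refine Finset.sum_congr rfl fun i _ => ?_
  rw [mul_pow, ← Real.rpow_natCast, ← Real.rpow_mul (hv i).le, Real.sqrt_eq_rpow,
    ← Real.rpow_neg (hv i).le]
  norm_num

/-- Monotonicity of `v̂` lets the current preconditioner be replaced by the previous one, the only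
one independent of the fresh randomness. The gradient error is then weighed with the worst entry
`1/c`. -/
theorem mahalanobisSq_le {v v' : Vec d} (hc : 0 < c) (hv : ∀ i, c ≤ √(v i))
    (hvv : ∀ i, v i ≤ v' i) (g h : Vec d) :
    mahalanobisSq v' g ≤ 2 * ∑ i, h i * ((√(v i))⁻¹ * h i) + 2 / c * ‖g - h‖ ^ 2 := by
  have hv0 : ∀ i, 0 < v i := fun i => Real.sqrt_pos.1 (hc.trans_le (hv i))
  rw [mahalanobisSq_eq_sum fun i => (hv0 i).trans_le (hvv i), EuclideanSpace.real_norm_sq_eq,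
    Finset.mul_sum, Finset.mul_sum, ← Finset.sum_add_distrib]
  refine Finset.sum_le_sum fun i _ => ?_
  have h1 : (√(v' i))⁻¹ ≤ (√(v i))⁻¹ :=
    inv_anti₀ (hc.trans_le (hv i)) (Real.sqrt_le_sqrt (hvv i))
  have h2 : (√(v i))⁻¹ ≤ c⁻¹ := inv_anti₀ hc (hv i)
  have h3 : 0 ≤ (√(v i))⁻¹ := by positivity
  have h4 : g i ^ 2 ≤ 2 * h i ^ 2 + 2 * (g i - h i) ^ 2 := by nlinarith [sq_nonneg (g i - 2 * h i)]
  calc (√(v' i))⁻¹ * g i ^ 2 ≤ (√(v i))⁻¹ * (2 * h i ^ 2 + 2 * (g i - h i) ^ 2) := by gcongr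
    _ = 2 * (h i * ((√(v i))⁻¹ * h i)) + 2 * (√(v i))⁻¹ * (g i - h i) ^ 2 := by ring
    _ ≤ 2 * (h i * ((√(v i))⁻¹ * h i)) + 2 * c⁻¹ * (g i - h i) ^ 2 := by gcongr
    _ = _ := by simp only [PiLp.sub_apply]; ring

end Mahalanobis

/-- The bound on the numerical constant of the quadratic terms. -/
theorem momentum_constant_le {β₁ β₂ γ : ℝ} (hβ₁ : 0 ≤ β₁) (hβ₁' : β₁ < 1) (hβ₂ : 0 < β₂)
    (hβ₂' : β₂ < 1) (hγ : γ = β₁ / β₂) (hγ1 : γ < 1) :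
    (5 / 2 * (β₁ ^ 2 / (1 - β₁ ^ 2 / β₂)) + 1) / (1 - β₂)
      ≤ (4 + 5 * β₁ ^ 2) * (1 - β₁) / (4 * (1 - β₁) ^ 2 * (1 - β₂) * (1 - γ)) := by
  have e : β₁ ^ 2 / β₂ = β₁ * γ := by rw [hγ]; ring
  have hγ0 : 0 ≤ γ := hγ ▸ div_nonneg hβ₁ hβ₂.le
  have h1 : 0 < 1 - β₁ := sub_pos.2 hβ₁'
  have h2 : 0 < 1 - γ := sub_pos.2 hγ1
  have h3 : 0 < 1 - β₂ := sub_pos.2 hβ₂'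
  have h4 : 1 - γ ≤ 1 - β₁ * γ := by nlinarith
  have h5 : 0 < 1 - β₁ * γ := h2.trans_le h4
  rw [e]
  have h6 : (4 + 5 * β₁ ^ 2) * (1 - β₁) / (4 * (1 - β₁) ^ 2 * (1 - β₂) * (1 - γ))
      = (1 + 5 / 4 * β₁ ^ 2) / ((1 - β₁) * (1 - γ)) / (1 - β₂) := by
    field_simp
  rw [h6]
  gcongr
  rw [le_div_iff₀ (by positivity)]
  have h7 : β₁ ^ 2 / (1 - β₁ * γ) * (1 - γ) ≤ β₁ ^ 2 := by
    rw [div_mul_eq_mul_div, div_le_iff₀ h5]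
    gcongr
  have h8 := mul_le_mul_of_nonneg_right h7 h1.le
  -- After bounding `1 - γ` by `1`, what remains is `β₁ (1 - 5/4 β₁ + 5/2 β₁²) ≥ 0`; the quadratic
  -- is `5/2 (β₁ - 1/4)²` plus a positive constant.
  nlinarith [sq_nonneg (β₁ - 1 / 4), mul_nonneg hβ₁ (sq_nonneg (β₁ - 1 / 4)),
    mul_nonneg h1.le hγ0]

end ZOAdaMM

/-! ### Expectations under independence. -/

theorem integral_comp_prodMk_of_indepFun {Ω 𝓐 𝓦 : Type*} [MeasurableSpace Ω] [MeasurableSpace 𝓐]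
    [MeasurableSpace 𝓦] {P : Measure Ω} [IsProbabilityMeasure P] {A : Ω → 𝓐} {W : Ω → 𝓦}
    (hA : Measurable A) (hW : Measurable W) (hAW : IndepFun A W P) {H : 𝓐 × 𝓦 → ℝ}
    (hH : Measurable H) (hint : Integrable (fun ω => H (A ω, W ω)) P) :
    ∫ ω, H (A ω, W ω) ∂P = ∫ ω, ∫ w, H (A ω, w) ∂(P.map W) ∂P := by
  have := Measure.isProbabilityMeasure_map (μ := P) hW.aemeasurable
  -- Independence makes the joint law a product, so Fubini integrates `W` out with `A` frozen.
  have hmap := hAW.map_prod_eq_prod_map_map hA.aemeasurable hW.aemeasurable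
  have hint' : Integrable H ((P.map A).prod (P.map W)) := by
    rw [← hmap]
    exact (integrable_map_measure hH.aestronglyMeasurable (hA.prodMk hW).aemeasurable).2 hint
  have h1 := integral_map (hA.prodMk hW).aemeasurable hH.aestronglyMeasurable (μ := P)
  rw [← h1, hmap, integral_prod _ hint', integral_map hA.aemeasurable]
  exact hH.stronglyMeasurable.integral_prod_right'.aestronglyMeasurable

/-- The mean of a process evaluated at an independent uniform index. -/
theorem integral_uniform_index {Ω : Type*} [MeasurableSpace Ω] {P : Measure Ω}
    [IsProbabilityMeasure P] {T : ℕ} (hT : 1 ≤ T) {R : Ω → ℕ} (hR : Measurable R)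
    (hlaw : ∀ t ∈ Finset.Icc 1 T, P {ω | R ω = t} = (T : ENNReal)⁻¹) {X : ℕ → Ω → ℝ}
    (hX : ∀ t ∈ Finset.Icc 1 T, Integrable (X t) P)
    (hind : ∀ t ∈ Finset.Icc 1 T, IndepFun (X t) R P) :
    Integrable (fun ω => X (R ω) ω) P ∧
      ∫ ω, X (R ω) ω ∂P = (T : ℝ)⁻¹ * ∑ t ∈ Finset.Icc 1 T, ∫ ω, X t ω ∂P := by
  -- The `T` prescribed masses `1/T` already add up to one, so no mass lies outside the range.
  have hmem : ∀ᵐ ω ∂P, R ω ∈ Finset.Icc 1 T := by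
    have hms : MeasurableSet {ω | R ω ∈ Finset.Icc 1 T} :=
      hR (Finset.Icc 1 T).measurableSet
    refine (mem_ae_iff_prob_eq_one hms).2 ?_
    have e : {ω | R ω ∈ Finset.Icc 1 T} = ⋃ t ∈ Finset.Icc 1 T, {ω | R ω = t} := by
      ext; simp
    rw [e, measure_biUnion_finset, Finset.sum_congr rfl hlaw, Finset.sum_const, Nat.card_Icc,
      Nat.add_sub_cancel, nsmul_eq_mul]
    · exact ENNReal.mul_inv_cancel (by simpa using Nat.one_le_iff_ne_zero.1 hT) (by simp)
    · intro a _ b _ hab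
      exact Set.disjoint_left.2 fun ω ha hb => hab (ha.symm.trans hb)
    · exact fun t _ => hR (measurableSet_singleton t)
  set φ : ℕ → ℕ → ℝ := fun t r => if r = t then 1 else 0 with hφ
  have hφR : ∀ t, Measurable fun ω => φ t (R ω) := fun t =>
    (measurable_of_countable (φ t)).comp hR
  have hφi : ∀ t ∈ Finset.Icc 1 T, ∫ ω, φ t (R ω) ∂P = (T : ℝ)⁻¹ := by
    intro t ht
    have e : (fun ω => φ t (R ω)) = {ω | R ω = t}.indicator 1 := by
      ext ω; simp [hφ, Set.indicator]
    have hms : MeasurableSet {ω | R ω = t} := hR (measurableSet_singleton t)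
    rw [e, integral_indicator_one hms, measureReal_def, hlaw t ht]
    simp
  have hint : ∀ t ∈ Finset.Icc 1 T, Integrable (fun ω => X t ω * φ t (R ω)) P := fun t ht =>
    (hX t ht).mul_bdd (c := 1) (hφR t).aestronglyMeasurable (.of_forall fun ω => by
      simp only [hφ]; split_ifs <;> simp)
  have hae : (fun ω => ∑ t ∈ Finset.Icc 1 T, X t ω * φ t (R ω)) =ᵐ[P] fun ω => X (R ω) ω := by
    filter_upwards [hmem] with ω hω
    simp only [hφ, mul_ite, mul_one, mul_zero]
    rw [Finset.sum_ite_eq, if_pos hω]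
  refine ⟨(integrable_finsetSum _ hint).congr hae, ?_⟩
  rw [← integral_congr_ae hae, integral_finsetSum _ hint, Finset.mul_sum]
  refine Finset.sum_congr rfl fun t ht => ?_
  have h := (hind t ht).comp measurable_id (measurable_of_countable (φ t))
  have h2 := h.integral_fun_mul_eq_mul_integral (hX t ht).aestronglyMeasurable
    (hφR t).aestronglyMeasurable
  simp only [Function.comp_def, id] at h2
  rw [h2, hφi t ht, mul_comm]

/-! ### Measurability of the run and its independence of fresh randomness. -/

namespace ZOAdaMM

variable {d : ℕ} {L η : ℝ} {Ξ : Type*} [MeasurableSpace Ξ] {F : Ξ → Vec d → ℝ}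

/-- A state-valued random variable all of whose components are measurable. -/
structure MeasurableState {Ω : Type*} [MeasurableSpace Ω] (S : Ω → State d) : Prop where
  x : Measurable fun ω => (S ω).x
  m : Measurable fun ω => (S ω).m
  v : Measurable fun ω => (S ω).v
  vhat : Measurable fun ω => (S ω).vhat

theorem measurableState_step {Ω : Type*} [MeasurableSpace Ω] {S : Ω → State d}
    (hS : MeasurableState S) {g : Ω → Vec d} (hg : Measurable g) (α β₁ β₂ : ℝ) :
    MeasurableState fun ω => step α β₁ β₂ (g ω) (S ω) := by
  have hvec : ∀ {w : Ω → Vec d}, Measurable w → ∀ i, Measurable fun ω => w ω i := fun h i =>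
    (measurable_apply_vec i).comp h
  have htoLp : ∀ {w : Ω → Fin d → ℝ}, (∀ i, Measurable fun ω => w ω i) →
      Measurable fun ω => (WithLp.toLp 2 (w ω) : Vec d) := fun h =>
    (WithLp.measurable_toLp 2 _).comp (measurable_pi_lambda _ h)
  have hm' : ∀ i, Measurable fun ω => β₁ * (S ω).m i + (1 - β₁) * g ω i := fun i =>
    ((hvec hS.m i).const_mul _).add ((hvec hg i).const_mul _)
  have hv' : ∀ i, Measurable fun ω => β₂ * (S ω).v i + (1 - β₂) * (g ω i) ^ 2 := fun i =>
    ((hvec hS.v i).const_mul _).add (((hvec hg i).pow_const 2).const_mul _)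
  have hvh' : ∀ i, Measurable fun ω => max ((S ω).vhat i)
      (β₂ * (S ω).v i + (1 - β₂) * (g ω i) ^ 2) := fun i => (hvec hS.vhat i).max (hv' i)
  have hx' : ∀ i, Measurable fun ω => (S ω).x i - α * ((β₁ * (S ω).m i + (1 - β₁) * g ω i)
      / √(max ((S ω).vhat i) (β₂ * (S ω).v i + (1 - β₂) * (g ω i) ^ 2))) := fun i =>
    (hvec hS.x i).sub (((hm' i).div (hvh' i).sqrt).const_mul _)
  exact ⟨htoLp hx', htoLp hm', htoLp hv', htoLp hvh'⟩

/-- The variables of the algorithm are measurable functions of the samples and directions used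
so far. -/
theorem measurable_run {Ω : Type*} [MeasurableSpace Ω] (hF_meas : ∀ x, Measurable fun s => F s x)
    (hF : ∀ s, IsSmoothBounded L η (F s)) (μ : ℝ) (α β₁ : ℕ → ℝ) (β₂ : ℝ) (x₁ vhat₀ : Vec d)
    {ξ : ℕ → Ω → Ξ} {u : ℕ → Ω → Metric.sphere (0 : Vec d) 1} (n : ℕ)
    (hξ : ∀ t ∈ Finset.Icc 1 n, Measurable (ξ t)) (hu : ∀ t ∈ Finset.Icc 1 n, Measurable (u t)) :
    MeasurableState fun ω => run F μ α β₁ β₂ x₁ vhat₀ (fun k => ξ k ω) (fun k => u k ω) n := by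
  induction n with
  | zero => exact ⟨measurable_const, measurable_const, measurable_const, measurable_const⟩
  | succ n ih =>
    have hS := ih (fun t ht => hξ t (Finset.Icc_subset_Icc_right n.le_succ ht))
      (fun t ht => hu t (Finset.Icc_subset_Icc_right n.le_succ ht))
    have hmem : n + 1 ∈ Finset.Icc 1 (n + 1) := by simp
    exact measurableState_step hS ((measurable_zoGrad hF_meas hF μ).comp
      (hS.x.prodMk ((hξ _ hmem).prodMk (hu _ hmem)))) _ _ _

end ZOAdaMM

namespace ZOAdaMM

variable {d T : ℕ} {L η : ℝ} {Ω Ξ : Type*} [mΩ : MeasurableSpace Ω] [MeasurableSpace Ξ]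
  {P : Measure Ω} {ν : Measure Ξ} {F : Ξ → Vec d → ℝ}
  {ξ : ℕ → Ω → Ξ} {u : ℕ → Ω → Metric.sphere (0 : Vec d) 1} {R : Ω → ℕ}

/-- The variables after `t` iterations are independent of the next sample and direction. -/
theorem IsSampling.indepFun_run (hsamp : IsSampling P ν T ξ u R)
    (hF_meas : ∀ x, Measurable fun s => F s x) (hF : ∀ s, IsSmoothBounded L η (F s)) (μ : ℝ)
    (α β₁ : ℕ → ℝ) (β₂ : ℝ) (x₁ vhat₀ : Vec d) {t : ℕ} (ht : t < T) :
    IndepFun (fun ω =>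
        ((run F μ α β₁ β₂ x₁ vhat₀ (fun k => ξ k ω) (fun k => u k ω) t).x,
          (run F μ α β₁ β₂ x₁ vhat₀ (fun k => ξ k ω) (fun k => u k ω) t).vhat))
      (fun ω => (ξ (t + 1) ω, u (t + 1) ω)) P := by
  obtain ⟨𝓜, h𝓜⟩ : ∃ 𝓜 : Finset.Icc 1 T → MeasurableSpace Ω, ∀ i,
      𝓜 i = MeasurableSpace.comap (fun ω => (ξ i ω, u i ω)) inferInstance := ⟨_, fun _ => rfl⟩
  have hle : ∀ i, 𝓜 i ≤ mΩ := fun i => by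
    rw [h𝓜]
    exact ((hsamp.measurable_sample i i.2).prodMk (hsamp.measurable_dir i i.2)).comap_le
  have hind : iIndep 𝓜 P := by
    rw [funext h𝓜]
    exact hsamp.indep_time.iIndep
  have hmem : t + 1 ∈ Finset.Icc 1 T := Finset.mem_Icc.2 ⟨by omega, ht⟩
  have hdisj : Disjoint {i : Finset.Icc 1 T | i.1 ≤ t} {⟨t + 1, hmem⟩} := by
    rw [Set.disjoint_singleton_right]
    simp
  have h := indep_iSup_of_disjoint hle hind hdisj
  rw [iSup_singleton, h𝓜] at h
  rw [IndepFun_iff_Indep]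
  refine indep_of_indep_of_le_left h ?_
  have hle2 : ∀ i ∈ {i : Finset.Icc 1 T | i.1 ≤ t},
      𝓜 i ≤ ⨆ i ∈ {i : Finset.Icc 1 T | i.1 ≤ t}, 𝓜 i := fun i hi => le_biSup 𝓜 hi
  generalize (⨆ i ∈ {i : Finset.Icc 1 T | i.1 ≤ t}, 𝓜 i) = 𝓢 at hle2
  have hpair : ∀ s ∈ Finset.Icc 1 t, @Measurable _ _ 𝓢 _ (fun ω => (ξ s ω, u s ω)) := by
    intro s hs
    have hs' := Finset.mem_Icc.1 hs
    have hsT : s ∈ Finset.Icc 1 T := Finset.mem_Icc.2 ⟨hs'.1, by omega⟩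
    have := hle2 ⟨s, hsT⟩ hs'.2
    rw [h𝓜] at this
    exact Measurable.mono (comap_measurable (fun ω => (ξ s ω, u s ω))) this le_rfl
  -- Measurability of the run is used with the σ-algebra of the first `t` pairs in place of the full
  -- one: this is the adaptedness that independence needs.
  have hS := @measurable_run d L η Ξ _ F Ω 𝓢
    hF_meas hF μ α β₁ β₂ x₁ vhat₀ ξ u t (fun s hs => (hpair s hs).fst)
    (fun s hs => (hpair s hs).snd)
  exact (hS.x.prodMk hS.vhat).comap_le

theorem measurable_mahalanobisSq :
    Measurable fun p : Vec d × Vec d => mahalanobisSq p.1 p.2 := by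
  unfold mahalanobisSq
  refine (Measurable.norm ?_).pow_const 2
  refine (WithLp.measurable_toLp 2 _).comp (measurable_pi_lambda _ fun i => ?_)
  exact (((measurable_apply_vec i).comp measurable_fst).pow_const _).mul
    ((measurable_apply_vec i).comp measurable_snd)

/-- The convergence measure at time `t` is independent of the random index. -/
theorem IsSampling.indepFun_mahalanobisSq (hsamp : IsSampling P ν T ξ u R)
    (hF_meas : ∀ x, Measurable fun s => F s x) (hF : ∀ s, IsSmoothBounded L η (F s)) (μ : ℝ)
    (α β₁ : ℕ → ℝ) (β₂ : ℝ) (x₁ vhat₀ : Vec d) {G : Vec d → Vec d} (hG : Measurable G) {t : ℕ}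
    (ht : t ≤ T) :
    IndepFun (fun ω => mahalanobisSq
        (vhat F μ α β₁ β₂ x₁ vhat₀ (fun k => ξ k ω) (fun k => u k ω) t)
        (G (iterate F μ α β₁ β₂ x₁ vhat₀ (fun k => ξ k ω) (fun k => u k ω) t))) R P := by
  have h := hsamp.indep_index
  rw [IndepFun_iff_Indep] at h ⊢
  refine indep_of_indep_of_le_left h ?_
  set 𝓜 := MeasurableSpace.comap (fun ω (t : Finset.Icc 1 T) => (ξ t ω, u t ω)) inferInstance
    with h𝓜
  have hpair : ∀ s ∈ Finset.Icc 1 T, @Measurable _ _ 𝓜 _ (fun ω => (ξ s ω, u s ω)) := by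
    intro s hs
    exact (measurable_pi_apply (⟨s, hs⟩ : Finset.Icc 1 T)).comp
      (comap_measurable (fun ω (t : Finset.Icc 1 T) => (ξ t ω, u t ω)))
  -- Again the run is measurable for a smaller σ-algebra, here the one generated by all pairs, which
  -- is independent of `R`.
  have hS : ∀ n ≤ T, _ := fun n hn => @measurable_run d L η Ξ _ F Ω 𝓜
    hF_meas hF μ α β₁ β₂ x₁ vhat₀ ξ u n
    (fun s hs => (hpair s (Finset.Icc_subset_Icc_right hn hs)).fst)
    (fun s hs => (hpair s (Finset.Icc_subset_Icc_right hn hs)).snd)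
  exact (measurable_mahalanobisSq.comp ((hS t ht).vhat.prodMk
    (hG.comp (hS (t - 1) (by omega)).x))).comap_le

variable [IsProbabilityMeasure P]

theorem IsSampling.law_pair (hsamp : IsSampling P ν T ξ u R) {t : ℕ} (ht : t ∈ Finset.Icc 1 T) :
    P.map (fun ω => (ξ t ω, u t ω)) = ν.prod (sphereUniform d) := by
  rw [(hsamp.indep_sample_dir t ht).map_prod_eq_prod_map_map
    (hsamp.measurable_sample t ht).aemeasurable (hsamp.measurable_dir t ht).aemeasurable,
    hsamp.law_sample t ht, hsamp.law_dir t ht]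

end ZOAdaMM

namespace ZOAdaMM

variable {d T : ℕ} {L η : ℝ} {Ω Ξ : Type*} [MeasurableSpace Ω] [MeasurableSpace Ξ]
  {P : Measure Ω} {ν : Measure Ξ} {F : Ξ → Vec d → ℝ}
  {ξ : ℕ → Ω → Ξ} {u : ℕ → Ω → Metric.sphere (0 : Vec d) 1} {R : Ω → ℕ}
  [IsProbabilityMeasure P] [IsProbabilityMeasure ν]

/-- In expectation, the gradient estimate preconditioned with the previous matrix may be replaced
by the smoothed gradient. -/
theorem IsSampling.integral_precond_gradEst (hsamp : IsSampling P ν T ξ u R) (hd : 1 ≤ d)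
    (hF_meas : ∀ x, Measurable fun s => F s x) (hF_int : ∀ x, Integrable (fun s => F s x) ν)
    (hF : ∀ s, IsSmoothBounded L η (F s)) {μ c : ℝ} (hμ : 0 < μ) (hc : 0 < c)
    (α β₁ : ℕ → ℝ) (β₂ : ℝ) (x₁ vhat₀ : Vec d) {t : ℕ} (ht : t < T) (i : Fin d)
    {S : Ω → State d}
    (hS : ∀ ω, S ω = run F μ α β₁ β₂ x₁ vhat₀ (fun k => ξ k ω) (fun k => u k ω) t)
    (hv : ∀ ω, c ≤ √((S ω).vhat i)) {Gm : Vec d → Vec d}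
    (hGm : Gm = smoothGrad μ (objective ν F)) :
    Integrable (fun ω => Gm (S ω).x i * ((√((S ω).vhat i))⁻¹ *
      zoGrad μ (F (ξ (t + 1) ω)) (u (t + 1) ω) (S ω).x i)) P ∧
    Integrable (fun ω => Gm (S ω).x i * ((√((S ω).vhat i))⁻¹ * Gm (S ω).x i)) P ∧
    ∫ ω, Gm (S ω).x i * ((√((S ω).vhat i))⁻¹ *
      zoGrad μ (F (ξ (t + 1) ω)) (u (t + 1) ω) (S ω).x i) ∂P
      = ∫ ω, Gm (S ω).x i * ((√((S ω).vhat i))⁻¹ * Gm (S ω).x i) ∂P := by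
  have hf := isSmoothBounded_objective hF_meas hF_int hF
  have hmem : t + 1 ∈ Finset.Icc 1 T := Finset.mem_Icc.2 ⟨by omega, ht⟩
  have hη : ∀ x, |Gm x i| ≤ η := fun x => hGm ▸ hf.abs_smoothGrad_le μ x i
  have hGc : Measurable Gm := hGm ▸ (hf.continuous_smoothGrad μ).measurable
  have hη0 : 0 ≤ η := (abs_nonneg _).trans (hη 0)
  have hSm : MeasurableState S := by
    have := measurable_run hF_meas hF μ α β₁ β₂ x₁ vhat₀ (ξ := ξ) (u := u) t
      (fun s hs => hsamp.measurable_sample s (Finset.Icc_subset_Icc_right ht.le hs))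
      (fun s hs => hsamp.measurable_dir s (Finset.Icc_subset_Icc_right ht.le hs))
    rwa [← funext hS] at this
  have hA : Measurable fun ω => ((S ω).x, (S ω).vhat) := hSm.x.prodMk hSm.vhat
  have hW : Measurable fun ω => (ξ (t + 1) ω, u (t + 1) ω) :=
    (hsamp.measurable_sample _ hmem).prodMk (hsamp.measurable_dir _ hmem)
  have hind : IndepFun (fun ω => ((S ω).x, (S ω).vhat))
      (fun ω => (ξ (t + 1) ω, u (t + 1) ω)) P := by
    have := hsamp.indepFun_run hF_meas hF μ α β₁ β₂ x₁ vhat₀ ht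
    simpa only [← hS] using this
  have hcoef : Measurable fun a : Vec d × Vec d => Gm a.1 i * (√(a.2 i))⁻¹ :=
    ((measurable_apply_vec i).comp (hGc.comp measurable_fst)).mul
      (((measurable_apply_vec i).comp measurable_snd).sqrt.inv)
  set H : (Vec d × Vec d) × (Ξ × Metric.sphere (0 : Vec d) 1) → ℝ := fun p =>
    Gm p.1.1 i * (√(p.1.2 i))⁻¹ * zoGrad μ (F p.2.1) p.2.2 p.1.1 i with hH
  have hHm : Measurable H := (hcoef.comp measurable_fst).mul ((measurable_apply_vec i).comp
    ((measurable_zoGrad hF_meas hF μ).comp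
      ((measurable_fst.comp measurable_fst).prodMk measurable_snd)))
  have hcoef_le : ∀ ω, |Gm (S ω).x i * (√((S ω).vhat i))⁻¹| ≤ η * c⁻¹ := by
    intro ω
    rw [abs_mul, abs_of_nonneg (inv_nonneg.2 (Real.sqrt_nonneg _))]
    exact mul_le_mul (hη _) (inv_anti₀ hc (hv ω)) (by positivity) hη0
  have hint1 : Integrable (fun ω => H (((S ω).x, (S ω).vhat), (ξ (t + 1) ω, u (t + 1) ω))) P := by
    refine .of_bound (hHm.comp (hA.prodMk hW)).aestronglyMeasurable
      (η * c⁻¹ * (d * (√d * η))) (.of_forall fun ω => ?_)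
    rw [Real.norm_eq_abs, hH, abs_mul]
    exact mul_le_mul (hcoef_le ω) ((hF _).abs_zoGrad_le hμ _ _ i) (abs_nonneg _) (by positivity)
  have hint2 : Integrable (fun ω => Gm (S ω).x i * (√((S ω).vhat i))⁻¹ * Gm (S ω).x i) P := by
    refine .of_bound ((hcoef.comp hA).mul ((measurable_apply_vec i).comp
      (hGc.comp hSm.x))).aestronglyMeasurable (η * c⁻¹ * η) (.of_forall fun ω => ?_)
    rw [Real.norm_eq_abs, abs_mul]
    exact mul_le_mul (hcoef_le ω) (hη _) (abs_nonneg _) (by positivity)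
  simp only [← mul_assoc]
  refine ⟨hint1, hint2, ?_⟩
  -- With the point and the lagged preconditioner frozen, the inner integral is the mean of the
  -- estimate at a fixed point.
  refine (integral_comp_prodMk_of_indepFun hA hW hind hHm hint1).trans ?_
  refine integral_congr_ae (.of_forall fun ω => ?_)
  simp only [hH]
  rw [integral_const_mul, hsamp.law_pair hmem,
    integral_prod_zoGrad hd hF_meas hF_int hF hμ, hGm]

end ZOAdaMM

/-! ### The convergence bound and the choice of parameters. -/

namespace ZOAdaMM

/-- The convergence bound for arbitrary step size and smoothing parameter. -/
theorem integral_mahalanobisSq_le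
    {d T : ℕ} (hd : 1 ≤ d) (hT : 1 ≤ T)
    {Ω Ξ : Type*} [MeasurableSpace Ω] [MeasurableSpace Ξ]
    (P : Measure Ω) [IsProbabilityMeasure P] (ν : Measure Ξ) [IsProbabilityMeasure ν]
    (F : Ξ → Vec d → ℝ)
    (hF_meas : ∀ x, Measurable fun s => F s x)
    (hF_int : ∀ x, Integrable (fun s => F s x) ν)
    (L η c Δ β₁ β₂ α μ : ℝ) (hL : 0 < L)
    (hF : ∀ s, IsSmoothBounded L η (F s))
    (x₁ vhat₀ : Vec d)
    (hc : 0 < c) (hvhat₀ : ∀ i, c ≤ √(vhat₀ i))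
    (hβ₁ : 0 ≤ β₁) (hβ₁' : β₁ < 1) (hβ₂ : 0 < β₂) (hβ₂' : β₂ < 1) (hθ : β₁ ^ 2 / β₂ < 1)
    (hμ : 0 < μ) (hα : 0 < α)
    (hΔ : ∀ x, smoothing μ (objective ν F) x₁ - smoothing μ (objective ν F) x ≤ Δ)
    (ξ : ℕ → Ω → Ξ) (u : ℕ → Ω → Metric.sphere (0 : Vec d) 1) (R : Ω → ℕ)
    (hsamp : IsSampling P ν T ξ u R)
    (x vhat ghat : ℕ → Ω → Vec d)
    (hx : ∀ t ω, x t ω = iterate F μ (fun _ => α) (fun _ => β₁) β₂ x₁ vhat₀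
      (fun k => ξ k ω) (fun k => u k ω) t)
    (hvhat : ∀ t ω, vhat t ω = ZOAdaMM.vhat F μ (fun _ => α) (fun _ => β₁) β₂ x₁ vhat₀
      (fun k => ξ k ω) (fun k => u k ω) t)
    (hghat : ∀ t ω, ghat t ω = gradEst F μ (fun _ => α) (fun _ => β₁) β₂ x₁ vhat₀
      (fun k => ξ k ω) (fun k => u k ω) t)
    (G : Ω → ℝ)
    (hG : ∀ ω, G ω = (Finset.Icc 1 T).sup' (Finset.nonempty_Icc.mpr hT)
      fun t => linfNorm (ghat t ω)) :
    Integrable (fun ω => mahalanobisSq (vhat (R ω) ω)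
      (gradient (objective ν F) (x (R ω) ω))) P ∧
    Integrable G P ∧
    ∫ ω, mahalanobisSq (vhat (R ω) ω) (gradient (objective ν F) (x (R ω) ω)) ∂P
      ≤ 2 / (T * α) * (Δ + α * (η * (∫ ω, G ω ∂P) / (1 - β₁)) * (d / c)
        + T * (L * α ^ 2 * (d * ((5 / 2 * (β₁ ^ 2 / (1 - β₁ ^ 2 / β₂)) + 1) / (1 - β₂)))))
        + 2 / c * (L * μ * d / 2) ^ 2 := by
  have : Nonempty (Fin d) := ⟨⟨0, hd⟩⟩
  have hf := isSmoothBounded_objective hF_meas hF_int hF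
  obtain ⟨s₀⟩ : Nonempty Ξ := ν.nonempty_of_neZero
  have hη0 : 0 ≤ η := (abs_nonneg _).trans ((hF s₀).abs_gradient_le 0 ⟨0, hd⟩)
  set Gm := smoothGrad μ (objective ν F) with hGm
  set S : ℕ → Ω → State d := fun t ω =>
    run F μ (fun _ => α) (fun _ => β₁) β₂ x₁ vhat₀ (fun k => ξ k ω) (fun k => u k ω) t with hSdef
  have hstep : ∀ ω t, S (t + 1) ω = step α β₁ β₂ (ghat (t + 1) ω) (S t ω) := fun ω t => by
    rw [hghat]; rfl
  -- The state after `t` iterations holds `x_{t+1}` next to `v̂_t`, so it already pairs each iterate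
  -- with the lagged preconditioner.
  have hxS : ∀ t ω, x (t + 1) ω = (S t ω).x := fun t ω => by rw [hx]; rfl
  have hvS : ∀ t ω, vhat t ω = (S t ω).vhat := fun t ω => by rw [hvhat]; rfl
  have hgS : ∀ t ω, ghat (t + 1) ω = zoGrad μ (F (ξ (t + 1) ω)) (u (t + 1) ω) (S t ω).x :=
    fun t ω => by rw [hghat]; rfl
  have hadm0 : ∀ ω, IsAdmissible c β₁ β₂ (S 0 ω) := fun ω =>
    ⟨hvhat₀, fun i => le_rfl,
      fun i => (Real.sqrt_pos.1 (hc.trans_le (hvhat₀ i))).le, fun i => by simp [hSdef, run]⟩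
  have hadm : ∀ t ω, IsAdmissible c β₁ β₂ (S t ω) := fun t ω =>
    isAdmissible_of_step (S := fun t => S t ω) (g := fun t => ghat t ω) (hadm0 ω) (hstep ω)
      hβ₂ hβ₂' t
  have hSm : ∀ t ≤ T, MeasurableState (S t) := fun t ht =>
    measurable_run hF_meas hF μ _ _ β₂ x₁ vhat₀ t
      (fun s hs => hsamp.measurable_sample s (Finset.Icc_subset_Icc_right ht hs))
      (fun s hs => hsamp.measurable_dir s (Finset.Icc_subset_Icc_right ht hs))
  have hgm : ∀ t ∈ Finset.Icc 1 T, Measurable (ghat t) := by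
    intro t ht
    obtain ⟨h1, h2⟩ := Finset.mem_Icc.1 ht
    obtain ⟨t, rfl⟩ := Nat.exists_eq_succ_of_ne_zero (by omega : t ≠ 0)
    rw [Nat.succ_eq_add_one, funext (hgS t)]
    exact (measurable_zoGrad hF_meas hF μ).comp ((hSm t (by omega)).x.prodMk
      ((hsamp.measurable_sample _ ht).prodMk (hsamp.measurable_dir _ ht)))
  have hgle : ∀ t ∈ Finset.Icc 1 T, ∀ ω i, |ghat t ω i| ≤ G ω := fun t ht ω i => by
    rw [hG]
    exact (abs_apply_le_linfNorm _ i).trans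
      (Finset.le_sup' (fun t => linfNorm (ghat t ω)) ht)
  have hlinf : Measurable fun v : Vec d => linfNorm v := (WithLp.measurable_ofLp 2 _).norm
  have hGmeas : Measurable G := by
    have : G = (Finset.Icc 1 T).sup' (Finset.nonempty_Icc.mpr hT)
        fun t ω => linfNorm (ghat t ω) := by
      ext ω; rw [hG, Finset.sup'_apply]
    rw [this]
    exact Finset.measurable_sup' _ fun t ht => hlinf.comp (hgm t ht)
  have hG0 : ∀ ω, 0 ≤ G ω := fun ω => (abs_nonneg _).trans
    (hgle 1 (Finset.mem_Icc.2 ⟨le_rfl, hT⟩) ω ⟨0, hd⟩)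
  have hGle : ∀ ω, G ω ≤ d * (√d * η) := by
    intro ω
    rw [hG]
    refine Finset.sup'_le _ _ fun t _ => ?_
    rw [hghat]
    exact (pi_norm_le_iff_of_nonneg (by positivity)).2 fun i => (hF _).abs_zoGrad_le hμ _ _ i
  have hGint : Integrable G P := .of_bound hGmeas.aestronglyMeasurable (d * (√d * η))
    (.of_forall fun ω => by rw [Real.norm_of_nonneg (hG0 ω)]; exact hGle ω)
  set X : ℕ → Ω → ℝ := fun t ω => mahalanobisSq (vhat t ω) (gradient (objective ν F) (x t ω))
    with hX
  set Q : ℕ → Ω → ℝ := fun t ω =>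
    ∑ i, Gm (S t ω).x i * ((√((S t ω).vhat i))⁻¹ * Gm (S t ω).x i) with hQ
  have hXle : ∀ t ω, X (t + 1) ω ≤ 2 * Q t ω + 2 / c * (L * μ * d / 2) ^ 2 := by
    intro t ω
    simp only [hX, hxS, hvS]
    have h1 := mahalanobisSq_le (v := (S t ω).vhat) (v' := (S (t + 1) ω).vhat) hc
      (hadm t ω).le_sqrt_vhat (fun i => by rw [hstep]; exact le_max_left _ _)
      (gradient (objective ν F) (S t ω).x) (Gm (S t ω).x)
    have h2 := pow_le_pow_left₀ (norm_nonneg _)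
      (hf.norm_gradient_sub_smoothGrad_le hd hL.le hμ.le (S t ω).x) 2
    have h3 := mul_le_mul_of_nonneg_left h2 (by positivity : 0 ≤ 2 / c)
    exact h1.trans (by linarith)
  have hprec : ∀ t < T, ∀ i, _ := fun t ht i =>
    hsamp.integral_precond_gradEst hd hF_meas hF_int hF hμ hc (fun _ => α) (fun _ => β₁) β₂ x₁
      vhat₀ ht i (S := S t) (fun _ => rfl) (fun ω => (hadm t ω).le_sqrt_vhat i) hGm
  have hQint : ∀ t < T, Integrable (Q t) P := fun t ht =>
    integrable_finsetSum _ fun i _ => (hprec t ht i).2.1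
  have hXint : ∀ t ∈ Finset.Icc 1 T, Integrable (X t) P := by
    intro t ht
    obtain ⟨h1, h2⟩ := Finset.mem_Icc.1 ht
    obtain ⟨t, rfl⟩ := Nat.exists_eq_succ_of_ne_zero (by omega : t ≠ 0)
    refine Integrable.mono' (((hQint t (by omega)).const_mul 2).add
      (integrable_const (2 / c * (L * μ * d / 2) ^ 2))) ?_ (.of_forall fun ω => ?_)
    · simp only [hX, Nat.succ_eq_add_one, hxS, hvS]
      exact (measurable_mahalanobisSq.comp ((hSm _ h2).vhat.prodMk
        (hf.continuous_gradient.measurable.comp (hSm t (by omega)).x))).aestronglyMeasurable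
    · rw [Real.norm_of_nonneg (by simp only [hX]; exact sq_nonneg _)]
      exact hXle t ω
  have hXind : ∀ t ∈ Finset.Icc 1 T, IndepFun (X t) R P := fun t ht => by
    simp only [hX, hx, hvhat]
    exact hsamp.indepFun_mahalanobisSq hF_meas hF μ _ _ β₂ x₁ vhat₀
      hf.continuous_gradient.measurable (Finset.mem_Icc.1 ht).2
  obtain ⟨hR1, hR2⟩ := integral_uniform_index hT hsamp.measurable_index hsamp.law_index hXint hXind
  refine ⟨hR1, hGint, hR2.trans_le ?_⟩
  set B := T * (L * α ^ 2 * (d * ((5 / 2 * (β₁ ^ 2 / (1 - β₁ ^ 2 / β₂)) + 1) / (1 - β₂)))) with hB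
  have hT0 : (0 : ℝ) < T := by exact_mod_cast hT
  have hpath : ∀ ω, α * ∑ t ∈ Finset.range T, ∑ i, Gm (S t ω).x i * ((√((S t ω).vhat i))⁻¹ *
      zoGrad μ (F (ξ (t + 1) ω)) (u (t + 1) ω) (S t ω).x i)
      ≤ Δ + α * (η * G ω / (1 - β₁)) * (d / c) + B := by
    intro ω
    have h := sum_inner_precond_le (S := fun t => S t ω) (g := fun t => ghat t ω) (hadm0 ω) rfl
      (hstep ω) hL.le hη0 (hf.smoothing_le μ) (hf.norm_smoothGrad_sub_le μ)
      (hf.abs_smoothGrad_le μ) hc hβ₁ hβ₁' hβ₂ hβ₂' hθ hα.le (hG0 ω) T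
      (fun t ht i => hgle (t + 1) (Finset.mem_Icc.2 ⟨by omega, ht⟩) ω i) hΔ
    simpa only [hgS] using h
  -- The pathwise bound keeps the random maximum `G`. Taking expectations replaces the estimates by
  -- smoothed gradients on the left and `G` by its mean on the right.
  have hmain : α * ∑ t ∈ Finset.range T, ∫ ω, Q t ω ∂P
      ≤ Δ + α * (η * (∫ ω, G ω ∂P) / (1 - β₁)) * (d / c) + B := by
    have e1 : ∑ t ∈ Finset.range T, ∫ ω, Q t ω ∂P = ∫ ω, ∑ t ∈ Finset.range T, ∑ i,
        Gm (S t ω).x i * ((√((S t ω).vhat i))⁻¹ *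
          zoGrad μ (F (ξ (t + 1) ω)) (u (t + 1) ω) (S t ω).x i) ∂P := by
      rw [integral_finsetSum _ fun t ht => integrable_finsetSum _ fun i _ =>
        (hprec t (Finset.mem_range.1 ht) i).1]
      refine Finset.sum_congr rfl fun t ht => ?_
      rw [integral_finsetSum _ fun i _ => (hprec t (Finset.mem_range.1 ht) i).1,
        integral_finsetSum _ fun i _ => (hprec t (Finset.mem_range.1 ht) i).2.1]
      exact Finset.sum_congr rfl fun i _ => (hprec t (Finset.mem_range.1 ht) i).2.2.symm
    have e2 : ∫ ω, (Δ + α * (η * G ω / (1 - β₁)) * (d / c) + B) ∂P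
        = Δ + α * (η * (∫ ω, G ω ∂P) / (1 - β₁)) * (d / c) + B := by
      have hi : Integrable (fun ω => α * (η * G ω / (1 - β₁)) * (d / c)) P :=
        ((((hGint.const_mul η).div_const _).const_mul α).mul_const _)
      rw [integral_add (f := fun ω => Δ + α * (η * G ω / (1 - β₁)) * (d / c))
          ((integrable_const _).add hi) (integrable_const _),
        integral_add (integrable_const _) hi, integral_mul_const, integral_const_mul,
        integral_div, integral_const_mul]
      simp
    rw [e1, ← integral_const_mul, ← e2]
    refine integral_mono (Integrable.const_mul (integrable_finsetSum _ fun t ht =>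
      integrable_finsetSum _ fun i _ => (hprec t (Finset.mem_range.1 ht) i).1) α) ?_ hpath
    exact ((integrable_const _).add
      ((((hGint.const_mul η).div_const _).const_mul α).mul_const _)).add (integrable_const _)
  have hsumX : ∑ t ∈ Finset.Icc 1 T, ∫ ω, X t ω ∂P
      ≤ 2 * ∑ t ∈ Finset.range T, ∫ ω, Q t ω ∂P + T * (2 / c * (L * μ * d / 2) ^ 2) := by
    have e : ∑ t ∈ Finset.Icc 1 T, ∫ ω, X t ω ∂P
        = ∑ t ∈ Finset.range T, ∫ ω, X (t + 1) ω ∂P := by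
      rw [Finset.range_eq_Ico, Finset.sum_Ico_add' (fun t => ∫ ω, X t ω ∂P) 0 T 1]
      rfl
    rw [e, Finset.mul_sum]
    have e2 : (T : ℝ) * (2 / c * (L * μ * d / 2) ^ 2)
        = ∑ _t ∈ Finset.range T, 2 / c * (L * μ * d / 2) ^ 2 := by simp
    rw [e2, ← Finset.sum_add_distrib]
    refine Finset.sum_le_sum fun t ht => ?_
    have ht' := Finset.mem_range.1 ht
    have h := integral_mono (hXint (t + 1) (Finset.mem_Icc.2 ⟨by omega, ht'⟩))
      (((hQint t ht').const_mul 2).add (integrable_const (2 / c * (L * μ * d / 2) ^ 2)))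
      (hXle t)
    refine h.trans_eq ?_
    simp only [Pi.add_apply]
    rw [integral_add ((hQint t ht').const_mul 2) (integrable_const _), integral_const_mul]
    simp
  calc (T : ℝ)⁻¹ * ∑ t ∈ Finset.Icc 1 T, ∫ ω, X t ω ∂P
      ≤ (T : ℝ)⁻¹ * (2 * ∑ t ∈ Finset.range T, ∫ ω, Q t ω ∂P
          + T * (2 / c * (L * μ * d / 2) ^ 2)) := by gcongr
    _ = 2 / (T * α) * (α * ∑ t ∈ Finset.range T, ∫ ω, Q t ω ∂P)
          + 2 / c * (L * μ * d / 2) ^ 2 := by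
        field_simp
    _ ≤ _ := by gcongr

/-- The convergence bound in terms of `√d` and `√T` when the step size and the smoothing
parameter are both `1 / √(T d)`. -/
theorem convergence_rate_le {d T L η c Δ K K' I β₁ : ℝ} (hd : 0 < d) (hT : 0 < T) (hL : 0 < L)
    (hc : 0 < c) (hK : K ≤ K') :
    2 / (T * (1 / √(T * d))) * (Δ + 1 / √(T * d) * (η * I / (1 - β₁)) * (d / c)
        + T * (L * (1 / √(T * d)) ^ 2 * (d * K))) + 2 / c * (L * (1 / √(T * d)) * d / 2) ^ 2
      ≤ L ^ 2 / (2 * c) * (d / T) + 2 * Δ * (√d / √T) + L * (2 * K') * (√d / √T)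
        + 2 / c * (2 * η ^ 2 + η * I / (1 - β₁)) * (d / T) := by
  rw [Real.sqrt_mul hT.le]
  -- Passing to `τ = √T` and `δ = √d` makes the comparison an identity of rational functions.
  obtain ⟨τ, hτ, rfl⟩ : ∃ τ, 0 < τ ∧ T = τ ^ 2 :=
    ⟨√T, Real.sqrt_pos.2 hT, (Real.sq_sqrt hT.le).symm⟩
  obtain ⟨δ, hδ, rfl⟩ : ∃ δ, 0 < δ ∧ d = δ ^ 2 :=
    ⟨√d, Real.sqrt_pos.2 hd, (Real.sq_sqrt hd.le).symm⟩
  rw [Real.sqrt_sq hτ.le, Real.sqrt_sq hδ.le]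
  have e : 2 / (τ ^ 2 * (1 / (τ * δ))) * (Δ + 1 / (τ * δ) * (η * I / (1 - β₁)) * (δ ^ 2 / c)
        + τ ^ 2 * (L * (1 / (τ * δ)) ^ 2 * (δ ^ 2 * K)))
        + 2 / c * (L * (1 / (τ * δ)) * δ ^ 2 / 2) ^ 2
      = L ^ 2 / (2 * c) * (δ ^ 2 / τ ^ 2) + 2 * Δ * (δ / τ) + L * (2 * K) * (δ / τ)
        + 2 / c * (η * I / (1 - β₁)) * (δ ^ 2 / τ ^ 2) := by
    generalize η * I / (1 - β₁) = J
    field_simp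
    ring
  rw [e]
  have h1 : L * (2 * K) * (δ / τ) ≤ L * (2 * K') * (δ / τ) := by gcongr
  -- The `2 η²` term of the stated bound is pure slack here: the telescoping argument does not
  -- produce it.
  have h2 : 0 ≤ 2 / c * (2 * η ^ 2) * (δ ^ 2 / τ ^ 2) := by positivity
  linarith

end ZOAdaMM

theorem proposition2
    {d T : ℕ} (hd : 1 ≤ d) (hT : 1 ≤ T)
    {Ω Ξ : Type*} [MeasurableSpace Ω] [MeasurableSpace Ξ]
    (P : Measure Ω) [IsProbabilityMeasure P] (ν : Measure Ξ) [IsProbabilityMeasure ν]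
    (F : Ξ → ZOAdaMM.Vec d → ℝ)
    (hF_meas : ∀ x, Measurable fun s => F s x)
    (hF_int : ∀ x, Integrable (fun s => F s x) ν)
    (L_g η c D_f β₁ β₂ γ μ : ℝ)
    -- each `f(·; ξ)` has an `L_g`-Lipschitz continuous gradient
    (hL : 0 < L_g)
    (hF_diff : ∀ s, Differentiable ℝ (F s))
    (hA1 : ∀ s x y, ‖gradient (F s) x - gradient (F s) y‖ ≤ L_g * ‖x - y‖)
    -- the stochastic gradients are bounded by `η` in the `ℓ_∞` norm
    (hA2 : ∀ s x, ZOAdaMM.linfNorm (gradient (F s) x) ≤ η)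
    (x₁ vhat₀ : ZOAdaMM.Vec d)
    (hc : 0 < c) (hvhat₀ : ∀ i, c ≤ √(vhat₀ i))
    (hβ₁ : 0 ≤ β₁) (hβ₂ : 0 < β₂) (hβ₂' : β₂ < 1) (hγ : γ = β₁ / β₂) (hγ1 : γ < 1)
    (hμ : μ = 1 / √((T : ℝ) * d))
    (hD : ∀ x, ZOAdaMM.smoothing μ (ZOAdaMM.objective ν F) x₁
      - ZOAdaMM.smoothing μ (ZOAdaMM.objective ν F) x ≤ D_f)
    (α : ℕ → ℝ) (hα : ∀ t, α t = 1 / √((T : ℝ) * d))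
    (ξ : ℕ → Ω → Ξ) (u : ℕ → Ω → Metric.sphere (0 : ZOAdaMM.Vec d) 1) (R : Ω → ℕ)
    (hsamp : ZOAdaMM.IsSampling P ν T ξ u R)
    -- the iterates `x_t`, the vectors `v̂_t` and the gradient estimates `ĝ_t`
    (x vhat ghat : ℕ → Ω → ZOAdaMM.Vec d)
    (hx : ∀ t ω, x t ω = ZOAdaMM.iterate F μ α (fun _ => β₁) β₂ x₁ vhat₀
      (fun k => ξ k ω) (fun k => u k ω) t)
    (hvhat : ∀ t ω, vhat t ω = ZOAdaMM.vhat F μ α (fun _ => β₁) β₂ x₁ vhat₀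
      (fun k => ξ k ω) (fun k => u k ω) t)
    (hghat : ∀ t ω, ghat t ω = ZOAdaMM.gradEst F μ α (fun _ => β₁) β₂ x₁ vhat₀
      (fun k => ξ k ω) (fun k => u k ω) t)
    -- `max_{t ∈ [T]} ‖ĝ_t‖_∞`
    (G : Ω → ℝ)
    (hG : ∀ ω, G ω = (Finset.Icc 1 T).sup' (Finset.nonempty_Icc.mpr hT)
      fun t => ZOAdaMM.linfNorm (ghat t ω)) :
    Integrable (fun ω => ZOAdaMM.mahalanobisSq (vhat (R ω) ω)
      (gradient (ZOAdaMM.objective ν F) (x (R ω) ω))) P ∧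
    Integrable G P ∧
    ∫ ω, ZOAdaMM.mahalanobisSq (vhat (R ω) ω)
        (gradient (ZOAdaMM.objective ν F) (x (R ω) ω)) ∂P
      ≤ L_g ^ 2 / (2 * c) * (d / T)
        + 2 * D_f * (√d / √T)
        + L_g * (4 + 5 * β₁ ^ 2) * (1 - β₁)
            / (2 * (1 - β₁) ^ 2 * (1 - β₂) * (1 - γ)) * (√d / √T)
        + 2 / c * (∫ ω, (2 * η ^ 2 + η * G ω / (1 - β₁)) ∂P) * (d / T) := by
  have hd0 : (0 : ℝ) < d := by exact_mod_cast hd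
  have hT0 : (0 : ℝ) < T := by exact_mod_cast hT
  have hβ₁₂ : β₁ < β₂ := by rwa [hγ, div_lt_one hβ₂] at hγ1
  have hβ₁' : β₁ < 1 := hβ₁₂.trans hβ₂'
  -- `β₁² ≤ β₁ < β₂`. The ratio `β₁²/β₂ = β₁ γ` replaces `γ` in the momentum estimate and is
  -- converted back in the final constant.
  have hθ : β₁ ^ 2 / β₂ < 1 := by
    rw [div_lt_one hβ₂]
    nlinarith
  have hμ0 : 0 < μ := hμ ▸ by positivity
  have hF : ∀ s, ZOAdaMM.IsSmoothBounded L_g η (F s) := fun s =>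
    ⟨hF_diff s, hA1 s, fun x i => (ZOAdaMM.abs_apply_le_linfNorm _ i).trans (hA2 s x)⟩
  obtain rfl : α = fun _ => μ := funext fun t => (hα t).trans hμ.symm
  obtain ⟨h1, h2, h3⟩ := ZOAdaMM.integral_mahalanobisSq_le hd hT P ν F hF_meas hF_int L_g η c D_f
    β₁ β₂ μ μ hL hF x₁ vhat₀ hc hvhat₀ hβ₁ hβ₁' hβ₂ hβ₂' hθ hμ0 hμ0 hD ξ u R hsamp x vhat ghat
    hx hvhat hghat G hG
  refine ⟨h1, h2, h3.trans ?_⟩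
  have h4 : ∫ ω, (2 * η ^ 2 + η * G ω / (1 - β₁)) ∂P
      = 2 * η ^ 2 + η * (∫ ω, G ω ∂P) / (1 - β₁) := by
    rw [integral_add (integrable_const _) ((h2.const_mul η).div_const _), integral_div,
      integral_const_mul η, integral_const, probReal_univ, one_smul]
  rw [h4, hμ]
  refine (ZOAdaMM.convergence_rate_le hd0 hT0 hL hc
    (ZOAdaMM.momentum_constant_le hβ₁ hβ₁' hβ₂ hβ₂' hγ hγ1)).trans_eq ?_
  have h5 : L_g * (2 * ((4 + 5 * β₁ ^ 2) * (1 - β₁) / (4 * (1 - β₁) ^ 2 * (1 - β₂) * (1 - γ))))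
      = L_g * (4 + 5 * β₁ ^ 2) * (1 - β₁) / (2 * (1 - β₁) ^ 2 * (1 - β₂) * (1 - γ)) := by
    have e1 : 1 - β₁ ≠ 0 := (sub_pos.2 hβ₁').ne'
    have e2 : 1 - β₂ ≠ 0 := (sub_pos.2 hβ₂').ne'
    have e3 : 1 - γ ≠ 0 := (sub_pos.2 hγ1).ne'
    field_simp
    norm_num
  rw [h5]
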